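/- Let $n\ge 3$ and $m\ge 2$ be integers. Let $W_n$ be the wheel with $n$ rim vertices and one hub ($n+1$ vertices, $2n$ edges), and fix any vertex $r$ of $W_n$. Define graphs $G^{(i)}=G^{(i,m,n)}$, $i\ge 0$, as follows: $G^{(0)}=W_n$, and $G^{(i+1)}$ is obtained from $G^{(i)}$ by replacing every edge of $G^{(i)}$ by a path of length $m$ (inserting $m-1$ new vertices) and attaching to every vertex $v$ of $G^{(i)}$ a new copy of $W_n$, identifying the vertex $r$ of the copy with $v$ (the vertices just inserted into edges receive no copy at this step). Let $\tau(G)$ denote the number of spanning trees of $G$, let $|V^{(0)}|=1$, and let $|V^{(i+1)}|$ be the number of vertices of $G^{(i)}$. Put $$\zeta=\sqrt{6(m-1)n+(m-1)^2+n^2},\qquad \alpha_1=m-n,\qquad \alpha_2=m+n,$$ $$A=\frac{4(m-1)}{(\zeta-\alpha_1+1)(\zeta+\alpha_2-1)^2},$$ $$B=\frac{4n\ln m}{(\zeta-\alpha_2+1)^2}\Bigl(-\zeta+m^2(n-1)+m\bigl(\zeta+n(-\zeta+3n-7)+2\bigr)+n(3\zeta-5n+6)-1\Bigr),$$ $$D=4^n(\sqrt5+1)^{-2n}\cos(2\pi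 n),$$ $$C=\frac{(\zeta+\alpha_2-1)\bigl(\zeta+m(n-1)-n(\zeta+n+4)+1\bigr)}{-\zeta+\alpha_2-1}\,\ln\!\left[\left(\tfrac12(\sqrt5+1)\right)^{2n}-2+D\right].$$ Then the entropy of the fractal exists and equals $$\sigma=\lim_{i\to\infty}\frac{\ln\tau(G^{(i)})}{|V^{(i)}|}=A\,(B+C).$$ -/

import Mathlib

namespace WheelFractal

/-- The wheel `W_n` (`n + 1` vertices): the join of the `n`-cycle with a single hub vertex. -/
def wheel (n : ℕ) : SimpleGraph (Fin n ⊕ Unit) :=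
  (SimpleGraph.cycleGraph n ⊕g (⊥ : SimpleGraph Unit)) ⊔ completeBipartiteGraph (Fin n) Unit

/-- Vertices of the graph obtained by inserting `m - 1` new vertices into every edge of `G`. -/
abbrev SubdivVertex {V : Type} (m : ℕ) (G : SimpleGraph V) : Type :=
  V ⊕ (G.edgeSet × Fin (m - 1))

/-- The vertices in positions `0, 1, …, m` of the path of length `m` that replaces the edge `e`;
positions `0` and `m` are the two ends of `e` (in an arbitrarily chosen order). -/
noncomputable def subdivPath {V : Type} (m : ℕ) (G : SimpleGraph V) (e : G.edgeSet)
    (k : Fin (m + 1)) : SubdivVertex m G :=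
  if h0 : k.val = 0 then Sum.inl (Quot.out e.val).1
  else if hm : k.val = m then Sum.inl (Quot.out e.val).2
  else Sum.inr (e, ⟨k.val - 1, by omega⟩)

/-- Edge-Path-Transformation: every edge of `G` is replaced by a path of length `m`. -/
noncomputable def subdivide {V : Type} (m : ℕ) (G : SimpleGraph V) :
    SimpleGraph (SubdivVertex m G) :=
  ⨆ e : G.edgeSet, (SimpleGraph.pathGraph (m + 1)).map (subdivPath m G e)

/-- The vertex `w` in the copy of a graph with root `r` that is attached at `f v`: the root is
identified with `f v`, all other vertices are new. -/
def copyVertex {V X U : Type} [DecidableEq U] (f : V → X) (r : U) (v : V) (w : U) :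
    X ⊕ (V × {u : U // u ≠ r}) :=
  if h : w = r then Sum.inl (f v) else Sum.inr (v, ⟨w, h⟩)

/-- Graph-linking-Vertex: for every `v : V` a new copy of `K` is attached to the graph `G` by
identifying the vertex `r` of the copy with the vertex `f v` of `G`. -/
def attach {V X U : Type} [DecidableEq U] (G : SimpleGraph X) (f : V → X) (K : SimpleGraph U)
    (r : U) : SimpleGraph (X ⊕ (V × {u : U // u ≠ r})) :=
  G.map Sum.inl ⊔ ⨆ v : V, K.map (copyVertex f r v)

/-- The fractal `G^(i)`: `G^(0)` is the wheel `W_n`; `G^(i+1)` arises from `G^(i)` by replacing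
every edge of `G^(i)` by a path of length `m` and attaching a new copy of `W_n`, by its vertex `r`,
at every vertex of `G^(i)` (the vertices inserted in the edges get no copy at this step). -/
noncomputable def fractal (n m : ℕ) (r : Fin n ⊕ Unit) : ℕ → (V : Type) × SimpleGraph V
  | 0 => ⟨_, wheel n⟩
  | i + 1 => ⟨_, attach (subdivide m (fractal n m r i).2) Sum.inl (wheel n) r⟩

/-- `|V^(i)|`: `|V^(0)| = 1`, and `|V^(i+1)|` is the number of vertices of `G^(i)`. -/
noncomputable def vertexCount (n m : ℕ) (r : Fin n ⊕ Unit) : ℕ → ℕ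
  | 0 => 1
  | i + 1 => Nat.card (fractal n m r i).1

/-- The number `τ(G)` of spanning trees of a (finite) graph `G`. -/
noncomputable def numSpanningTrees {V : Type} (G : SimpleGraph V) : ℕ :=
  {T : SimpleGraph V | T ≤ G ∧ T.IsTree}.ncard

noncomputable def zeta (n m : ℝ) : ℝ := √(6 * (m - 1) * n + (m - 1) ^ 2 + n ^ 2)

noncomputable def alpha₁ (n m : ℝ) : ℝ := m - n

noncomputable def alpha₂ (n m : ℝ) : ℝ := m + n

noncomputable def coeffA (n m : ℝ) : ℝ :=
  4 * (m - 1) / ((zeta n m - alpha₁ n m + 1) * (zeta n m + alpha₂ n m - 1) ^ 2)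

noncomputable def coeffB (n m : ℝ) : ℝ :=
  4 * n * Real.log m / (zeta n m - alpha₂ n m + 1) ^ 2 *
    (-zeta n m + m ^ 2 * (n - 1) + m * (zeta n m + n * (-zeta n m + 3 * n - 7) + 2)
      + n * (3 * zeta n m - 5 * n + 6) - 1)

noncomputable def coeffD (n : ℕ) : ℝ :=
  4 ^ n * (√5 + 1) ^ (-(2 * n : ℤ)) * Real.cos (2 * Real.pi * n)

noncomputable def coeffC (n : ℕ) (m : ℝ) : ℝ :=
  1 / (-zeta n m + alpha₂ n m - 1) * (zeta n m + alpha₂ n m - 1) *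
    (zeta n m + m * (n - 1) - n * (zeta n m + n + 4) + 1) *
    Real.log ((1 / 2 * (√5 + 1)) ^ (2 * n) - 2 + coeffD n)

end WheelFractal

/-!
Attaching a copy of `W_n` at each of the `|V|` vertices of a graph multiplies the number of spanning
trees by `τ(W_n) ^ |V|`. Replacing the edges by paths of length `m` multiplies it by
`m ^ (|E| - |V| + 1)`: a spanning tree of the subdivision omits exactly one path edge over each edge
outside a spanning tree of the original graph. Hence `ln τ(G^(i+1)) - ln τ(G^(i))` is an affine
function of `|V|` and `|E|`, which satisfy a linear recurrence. The slope of the dominant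
eigenvector of the recurrence is the limit of `|E| / |V|`, and the Stolz–Cesàro theorem turns the
limit of the increments into the limit of the quotients.

A spanning tree of `W_n`, rooted at the hub, is a map that sends each rim vertex to its parent: the
hub or one of its two rim neighbours. Such a map is given by a cyclic word over three letters; the
only forbidden pattern is a pair of adjacent vertices that are each other's parents, and of the
words without it exactly the two rotations of the rim fail to reach the hub. The transfer matrix has
eigenvalues `0`, `φ ^ 2` and `ψ ^ 2`, where `ψ = -φ⁻¹`, so that
`τ(W_n) = φ ^ (2 * n) + ψ ^ (2 * n) - 2`.
-/

namespace WheelFractal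

open SimpleGraph

/-! ### Reachability, connectedness and spanning trees -/

theorem reachable_of_forall_adj {V W : Type*} {G : SimpleGraph V} {H : SimpleGraph W} (f : V → W)
    (hf : ∀ a b, G.Adj a b → H.Reachable (f a) (f b)) {a b : V} (h : G.Reachable a b) :
    H.Reachable (f a) (f b) := by
  obtain ⟨p⟩ := h
  induction p with
  | nil => exact Reachable.refl _
  | cons hadj _ ih => exact (hf _ _ hadj).trans ih

theorem eq_of_reachable_of_forall_adj {V α : Type*} {G : SimpleGraph V} (f : V → α)
    (hf : ∀ a b, G.Adj a b → f a = f b) {a b : V} (h : G.Reachable a b) : f a = f b :=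
  reachable_bot.1 (reachable_of_forall_adj f (fun a b hab => reachable_bot.2 (hf a b hab)) h)

theorem connected_of_surjective_of_forall_adj {V W : Type*} {G : SimpleGraph V}
    {H : SimpleGraph W} {f : V → W} (hsurj : Function.Surjective f)
    (hf : ∀ a b, G.Adj a b → f a = f b ∨ H.Adj (f a) (f b)) (hG : G.Connected) :
    H.Connected := by
  have := hG.nonempty.map f
  refine ⟨fun a b => ?_⟩
  obtain ⟨a, rfl⟩ := hsurj a
  obtain ⟨b, rfl⟩ := hsurj b
  refine reachable_of_forall_adj f (fun a b hab => ?_) (hG.preconnected a b)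
  rcases hf a b hab with h | h
  · rw [h]
  · exact h.reachable

/-- The spanning trees of `G`, encoded as the subgraphs of `G` on the whole vertex type that are
trees. -/
abbrev SpanningTree {V : Type*} (G : SimpleGraph V) : Type _ :=
  {T : SimpleGraph V // T ≤ G ∧ T.IsTree}

theorem numSpanningTrees_eq_natCard {V : Type} (G : SimpleGraph V) :
    numSpanningTrees G = Nat.card (SpanningTree G) := rfl

theorem numSpanningTrees_pos {V : Type} [Finite V] {G : SimpleGraph V} (hG : G.Connected) :
    0 < numSpanningTrees G := by
  obtain ⟨T, hTG, hT⟩ := hG.exists_isTree_le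
  exact (Set.ncard_pos (Set.toFinite _)).2 ⟨T, hTG, hT⟩

/-! ### Attaching copies of a rooted graph -/

theorem natCard_attachVertex {V X U : Type} [Finite V] [Finite X] [Finite U] (r : U) :
    Nat.card (X ⊕ (V × {u : U // u ≠ r})) = Nat.card X + Nat.card V * (Nat.card U - 1) := by
  classical
  have := Fintype.ofFinite U
  rw [Nat.card_sum, Nat.card_prod, Nat.card_eq_fintype_card (α := {u : U // u ≠ r}),
    Fintype.card_subtype_compl, Fintype.card_subtype_eq, Nat.card_eq_fintype_card (α := U)]

theorem exists_mem_edge_ne {U : Type*} {K : SimpleGraph U} {e : Sym2 U} (he : e ∈ K.edgeSet)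
    (r : U) : ∃ w ∈ e, w ≠ r := by
  induction e with | _ a b =>
  by_cases ha : a = r
  · exact ⟨b, Sym2.mem_mk_right a b, fun hb => (K.mem_edgeSet.1 he).ne (ha.trans hb.symm)⟩
  · exact ⟨a, Sym2.mem_mk_left a b, ha⟩

section Attach

variable {V X U : Type} [DecidableEq U]

@[simp] theorem copyVertex_root (f : V → X) (r : U) (v : V) :
    copyVertex f r v r = Sum.inl (f v) := dif_pos rfl

theorem copyVertex_of_ne (f : V → X) {r : U} (v : V) {w : U} (h : w ≠ r) :
    copyVertex f r v w = Sum.inr (v, ⟨w, h⟩) := dif_neg h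

theorem copyVertex_eq_inl {f : V → X} {r : U} {v : V} {w : U} {x : X} :
    copyVertex f r v w = Sum.inl x ↔ w = r ∧ f v = x := by
  unfold copyVertex
  split_ifs with h <;> simp [h]

theorem copyVertex_injective (f : V → X) (r : U) (v : V) :
    Function.Injective (copyVertex f r v) := by
  intro a b h
  unfold copyVertex at h
  split_ifs at h <;> simp_all

theorem copyVertex_eq_copyVertex {f : V → X} {r : U} {v v' : V} {w w' : U} (hw : w ≠ r)
    (h : copyVertex f r v' w' = copyVertex f r v w) : v' = v ∧ w' = w := by
  unfold copyVertex at h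
  split_ifs at h
  simpa using h

/-- The graph `G` with, for every `v`, a copy of `K v` attached by its vertex `r` at `f v`. The
subgraphs of `attach G f K r` are of this form, with `K v` a subgraph of `K` that may depend on
`v`. -/
def attachFamily (G : SimpleGraph X) (f : V → X) (K : V → SimpleGraph U) (r : U) :
    SimpleGraph (X ⊕ (V × {u : U // u ≠ r})) :=
  G.map Sum.inl ⊔ ⨆ v : V, (K v).map (copyVertex f r v)

variable {G G' : SimpleGraph X} {f : V → X} {K K' : V → SimpleGraph U} {r : U}
  {T : SimpleGraph (X ⊕ (V × {u : U // u ≠ r}))}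

theorem attachFamily_adj {a b : X ⊕ (V × {u : U // u ≠ r})} :
    (attachFamily G f K r).Adj a b ↔
      (∃ x y, G.Adj x y ∧ Sum.inl x = a ∧ Sum.inl y = b) ∨
      ∃ v x y, (K v).Adj x y ∧ copyVertex f r v x = a ∧ copyVertex f r v y = b := by
  simp only [attachFamily, sup_adj, iSup_adj, map_adj']
  constructor
  · rintro (⟨-, h⟩ | ⟨v, -, h⟩)
    · exact Or.inl h
    · exact Or.inr ⟨v, h⟩
  · rintro (⟨x, y, h, rfl, rfl⟩ | ⟨v, x, y, h, rfl, rfl⟩)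
    · exact Or.inl ⟨fun h' => h.ne (Sum.inl_injective h'), x, y, h, rfl, rfl⟩
    · exact Or.inr ⟨v, fun h' => h.ne (copyVertex_injective f r v h'), x, y, h, rfl, rfl⟩

variable (G f K r) in
/-- The inclusion of the base graph. -/
def attachBaseHom : G →g attachFamily G f K r where
  toFun := Sum.inl
  map_rel' {a b} h := attachFamily_adj.2 (Or.inl ⟨a, b, h, rfl, rfl⟩)

variable (G f K r) in
/-- The inclusion of the copy attached at `f v`. -/
def attachCopyHom (v : V) : K v →g attachFamily G f K r where
  toFun := copyVertex f r v
  map_rel' {a b} h := attachFamily_adj.2 (Or.inr ⟨v, a, b, h, rfl, rfl⟩)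

variable (G f K r) in
theorem attachFamily_comap_inl : (attachFamily G f K r).comap Sum.inl = G := by
  ext a b
  rw [comap_adj]
  refine ⟨fun h => ?_, (attachBaseHom G f K r).map_adj⟩
  rcases attachFamily_adj.1 h with ⟨x, y, h, hx, hy⟩ | ⟨v, x, y, h, hx, hy⟩
  · rwa [← Sum.inl_injective hx, ← Sum.inl_injective hy]
  · rw [copyVertex_eq_inl] at hx hy
    exact absurd (hx.1.trans hy.1.symm) h.ne

variable (G f K r) in
theorem attachFamily_comap_copyVertex (v : V) :
    (attachFamily G f K r).comap (copyVertex f r v) = K v := by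
  ext a b
  rw [comap_adj]
  refine ⟨fun h => ?_, (attachCopyHom G f K r v).map_adj⟩
  rcases attachFamily_adj.1 h with ⟨x, y, h, hx, hy⟩ | ⟨v', x, y, h, hx, hy⟩
  · have hfx := (copyVertex_eq_inl.1 hx.symm).2
    have hfy := (copyVertex_eq_inl.1 hy.symm).2
    exact absurd (hfx.symm.trans hfy) h.ne
  · obtain rfl : v' = v := by
      by_cases ha : a = r
      · have hb : b ≠ r := fun hb => h.ne <| copyVertex_injective f r v' <| by
          rw [hx, hy, ha, hb]
        exact (copyVertex_eq_copyVertex hb hy).1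
      · exact (copyVertex_eq_copyVertex ha hx).1
    rwa [← copyVertex_injective f r v' hx, ← copyVertex_injective f r v' hy]

theorem attachFamily_mono (hG : G ≤ G') (hK : ∀ v, K v ≤ K' v) :
    attachFamily G f K r ≤ attachFamily G' f K' r :=
  sup_le_sup (map_monotone _ hG) (iSup_mono fun v => map_monotone _ (hK v))

theorem attachFamily_comap_eq_of_le (hT : T ≤ attachFamily G f K r) :
    attachFamily (T.comap Sum.inl) f (fun v => T.comap (copyVertex f r v)) r = T := by
  ext a b
  rw [attachFamily_adj]
  constructor
  · rintro (⟨x, y, h, rfl, rfl⟩ | ⟨v, x, y, h, rfl, rfl⟩) <;> exact h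
  · intro h
    rcases attachFamily_adj.1 (hT h) with ⟨x, y, -, rfl, rfl⟩ | ⟨v, x, y, -, rfl, rfl⟩
    · exact Or.inl ⟨x, y, h, rfl, rfl⟩
    · exact Or.inr ⟨v, x, y, h, rfl, rfl⟩

theorem comap_inl_le (hT : T ≤ attachFamily G f K r) : T.comap Sum.inl ≤ G :=
  (comap_monotone .inl hT).trans_eq (attachFamily_comap_inl G f K r)

theorem comap_copyVertex_le (hT : T ≤ attachFamily G f K r) (v : V) :
    T.comap (copyVertex f r v) ≤ K v :=
  (comap_monotone ⟨_, copyVertex_injective f r v⟩ hT).trans_eq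
    (attachFamily_comap_copyVertex G f K r v)

theorem base_connected_of_attachFamily (h : (attachFamily G f K r).Connected) : G.Connected := by
  let toBase : X ⊕ (V × {u : U // u ≠ r}) → X := Sum.elim id fun p => f p.1
  have toBase_copyVertex (v w) : toBase (copyVertex f r v w) = f v := by
    by_cases hw : w = r
    · rw [hw, copyVertex_root]; rfl
    · rw [copyVertex_of_ne f v hw]; rfl
  refine connected_of_surjective_of_forall_adj (f := toBase) (fun x => ⟨Sum.inl x, rfl⟩) ?_ h
  intro a b hab
  rcases attachFamily_adj.1 hab with ⟨x, y, hxy, rfl, rfl⟩ | ⟨v, x, y, -, rfl, rfl⟩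
  · exact Or.inr hxy
  · exact Or.inl (by rw [toBase_copyVertex, toBase_copyVertex])

theorem copy_connected_of_attachFamily (h : (attachFamily G f K r).Connected) (v : V) :
    (K v).Connected := by
  classical
  let toCopy : X ⊕ (V × {u : U // u ≠ r}) → U :=
    Sum.elim (fun _ => r) fun p => if p.1 = v then p.2.1 else r
  have toCopy_copyVertex (v' w) :
      toCopy (copyVertex f r v' w) = if v' = v then w else r := by
    by_cases hw : w = r
    · simp [hw, toCopy]
    · rw [copyVertex_of_ne f v' hw]; rfl
  refine connected_of_surjective_of_forall_adj (f := toCopy)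
    (fun w => ⟨copyVertex f r v w, by rw [toCopy_copyVertex, if_pos rfl]⟩) ?_ h
  intro a b hab
  rcases attachFamily_adj.1 hab with ⟨x, y, -, rfl, rfl⟩ | ⟨v', x, y, hxy, rfl, rfl⟩
  · exact Or.inl rfl
  · rw [toCopy_copyVertex, toCopy_copyVertex]
    split_ifs with hv
    · exact Or.inr (hv ▸ hxy)
    · exact Or.inl rfl

theorem attachFamily_connected (hG : G.Connected) (hK : ∀ v, (K v).Connected) :
    (attachFamily G f K r).Connected := by
  obtain ⟨x₀⟩ := hG.nonempty
  have reachable_base (x) : (attachFamily G f K r).Reachable (Sum.inl x₀) (Sum.inl x) :=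
    (hG.preconnected x₀ x).map (attachBaseHom G f K r)
  refine (connected_iff_exists_forall_reachable _).2 ⟨Sum.inl x₀, ?_⟩
  rintro (x | ⟨v, w, hw⟩)
  · exact reachable_base x
  · have reachable_copy := ((hK v).preconnected r w).map (attachCopyHom G f K r v)
    change (attachFamily G f K r).Reachable (copyVertex f r v r) (copyVertex f r v w)
      at reachable_copy
    rw [copyVertex_root, copyVertex_of_ne f v hw] at reachable_copy
    exact (reachable_base (f v)).trans reachable_copy

theorem attachFamily_connected_iff :
    (attachFamily G f K r).Connected ↔ G.Connected ∧ ∀ v, (K v).Connected :=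
  ⟨fun h => ⟨base_connected_of_attachFamily h, copy_connected_of_attachFamily h⟩,
    fun h => attachFamily_connected h.1 h.2⟩

theorem base_isTree_of_attachFamily (h : (attachFamily G f K r).IsTree) : G.IsTree := by
  rw [isTree_iff_minimal_connected] at h ⊢
  obtain ⟨hG, hK⟩ := attachFamily_connected_iff.1 h.prop
  refine ⟨hG, fun G' hG' hle => ?_⟩
  have hmin := h.le_of_le (attachFamily_connected hG' hK) (attachFamily_mono hle fun _ => le_rfl)
  rw [← attachFamily_comap_inl G f K r]
  exact comap_inl_le hmin

theorem copy_isTree_of_attachFamily (h : (attachFamily G f K r).IsTree) (v : V) :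
    (K v).IsTree := by
  classical
  rw [isTree_iff_minimal_connected] at h ⊢
  obtain ⟨hG, hK⟩ := attachFamily_connected_iff.1 h.prop
  refine ⟨hK v, fun L hL hle => ?_⟩
  have hconn : (attachFamily G f (Function.update K v L) r).Connected :=
    attachFamily_connected hG <|
      (Function.forall_update_iff K fun _ H => H.Connected).2 ⟨hL, fun v' _ => hK v'⟩
  have hmin := h.le_of_le hconn <| attachFamily_mono le_rfl <|
    (Function.forall_update_iff K fun v' H => H ≤ K v').2 ⟨hle, fun _ _ => le_rfl⟩
  rw [← attachFamily_comap_copyVertex G f K r v]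
  simpa only [Function.update_self] using comap_copyVertex_le hmin v

theorem attachFamily_isTree (hG : G.IsTree) (hK : ∀ v, (K v).IsTree) :
    (attachFamily G f K r).IsTree := by
  simp only [isTree_iff_minimal_connected] at hG hK ⊢
  refine ⟨attachFamily_connected hG.prop fun v => (hK v).prop, fun T hT hle => ?_⟩
  change T ≤ attachFamily G f K r at hle
  rw [← attachFamily_comap_eq_of_le hle] at hT ⊢
  obtain ⟨hbase, hcopy⟩ := attachFamily_connected_iff.1 hT
  exact attachFamily_mono (hG.le_of_le hbase (comap_inl_le hle)) fun v =>
    (hK v).le_of_le (hcopy v) (comap_copyVertex_le hle v)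

theorem attachFamily_isTree_iff :
    (attachFamily G f K r).IsTree ↔ G.IsTree ∧ ∀ v, (K v).IsTree :=
  ⟨fun h => ⟨base_isTree_of_attachFamily h, copy_isTree_of_attachFamily h⟩,
    fun h => attachFamily_isTree h.1 h.2⟩

theorem comap_isTree_of_le (hT : T ≤ attachFamily G f K r) (h : T.IsTree) :
    (T.comap Sum.inl).IsTree ∧ ∀ v, (T.comap (copyVertex f r v)).IsTree := by
  rwa [← attachFamily_comap_eq_of_le hT, attachFamily_isTree_iff] at h

variable (G f K r) in
/-- A spanning tree of `attachFamily G f K r` amounts to its traces on the base and on the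
copies. -/
def spanningTreeAttachFamilyEquiv :
    SpanningTree (attachFamily G f K r) ≃ SpanningTree G × ∀ v, SpanningTree (K v) where
  toFun T := ⟨⟨T.1.comap Sum.inl, comap_inl_le T.2.1, (comap_isTree_of_le T.2.1 T.2.2).1⟩,
    fun v => ⟨T.1.comap (copyVertex f r v), comap_copyVertex_le T.2.1 v,
      (comap_isTree_of_le T.2.1 T.2.2).2 v⟩⟩
  invFun p := ⟨attachFamily p.1.1 f (fun v => (p.2 v).1) r,
    attachFamily_mono p.1.2.1 fun v => (p.2 v).2.1,
    attachFamily_isTree p.1.2.2 fun v => (p.2 v).2.2⟩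
  left_inv T := Subtype.ext (attachFamily_comap_eq_of_le T.2.1)
  right_inv _ := Prod.ext (Subtype.ext (attachFamily_comap_inl _ _ _ _))
    (funext fun _ => Subtype.ext (attachFamily_comap_copyVertex _ _ _ _ _))

theorem attach_eq_attachFamily (G : SimpleGraph X) (f : V → X) (K : SimpleGraph U) (r : U) :
    attach G f K r = attachFamily G f (fun _ => K) r := rfl

theorem attach_connected {K : SimpleGraph U} (hG : G.Connected) (hK : K.Connected) :
    (attach G f K r).Connected :=
  attachFamily_connected hG fun _ => hK

theorem numSpanningTrees_attach [Finite V] (G : SimpleGraph X) (f : V → X) (K : SimpleGraph U)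
    (r : U) : numSpanningTrees (attach G f K r) =
      numSpanningTrees G * numSpanningTrees K ^ Nat.card V := by
  simp only [numSpanningTrees_eq_natCard, attach_eq_attachFamily]
  rw [Nat.card_congr (spanningTreeAttachFamilyEquiv G f (fun _ => K) r), Nat.card_prod,
    Nat.card_fun]

/-- The edges of `attach G f K r`, listed as those of the base and those of the copies. -/
def attachEdge (G : SimpleGraph X) (f : V → X) (K : SimpleGraph U) (r : U) :
    G.edgeSet ⊕ (V × K.edgeSet) → Sym2 (X ⊕ (V × {u : U // u ≠ r})) :=
  Sum.elim (fun e => e.1.map Sum.inl) fun p => p.2.1.map (copyVertex f r p.1)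

theorem map_inl_ne_map_copyVertex {K : SimpleGraph U} {e : Sym2 U} (he : e ∈ K.edgeSet)
    (e' : Sym2 X) (v : V) : e'.map Sum.inl ≠ e.map (copyVertex f r v) := by
  intro h
  obtain ⟨w, hw, hwr⟩ := exists_mem_edge_ne he r
  obtain ⟨x, -, hx⟩ := Sym2.mem_map.1 (h ▸ Sym2.mem_map.2 ⟨w, hw, rfl⟩)
  exact hwr (copyVertex_eq_inl.1 hx.symm).1

theorem attachEdge_injective (G : SimpleGraph X) (f : V → X) (K : SimpleGraph U) (r : U) :
    Function.Injective (attachEdge G f K r) := by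
  rintro (⟨e, he⟩ | ⟨v, e, he⟩) (⟨e', he'⟩ | ⟨v', e', he'⟩) h <;>
    simp only [attachEdge, Sum.elim_inl, Sum.elim_inr] at h
  · cases Sym2.map.injective Sum.inl_injective h
    rfl
  · exact absurd h (map_inl_ne_map_copyVertex he' e v')
  · exact absurd h.symm (map_inl_ne_map_copyVertex he e' v)
  · obtain ⟨w, hw, hwr⟩ := exists_mem_edge_ne he r
    obtain ⟨x, -, hx⟩ := Sym2.mem_map.1 (h ▸ Sym2.mem_map.2 ⟨w, hw, rfl⟩)
    obtain ⟨rfl, -⟩ := copyVertex_eq_copyVertex hwr hx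
    cases Sym2.map.injective (copyVertex_injective f r v') h
    rfl

theorem range_attachEdge (G : SimpleGraph X) (f : V → X) (K : SimpleGraph U) (r : U) :
    Set.range (attachEdge G f K r) = (attach G f K r).edgeSet := by
  have hbase := edgeSet_map (⟨Sum.inl, Sum.inl_injective⟩ : X ↪ X ⊕ (V × {u : U // u ≠ r})) G
  have hcopy (v : V) := edgeSet_map ⟨copyVertex f r v, copyVertex_injective f r v⟩ K
  simp only [Function.Embedding.coeFn_mk, Function.Embedding.sym2Map_apply] at hbase hcopy
  rw [attach, edgeSet_sup, edgeSet_iSup, hbase]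
  simp only [hcopy]
  ext e
  simp [attachEdge]

theorem card_edgeSet_attach [Finite V] [Finite X] [Finite U] (G : SimpleGraph X) (f : V → X)
    (K : SimpleGraph U) (r : U) : Nat.card (attach G f K r).edgeSet =
      Nat.card G.edgeSet + Nat.card V * Nat.card K.edgeSet := by
  rw [← range_attachEdge, Nat.card_range_of_injective (attachEdge_injective G f K r),
    Nat.card_sum, Nat.card_prod]

end Attach

/-! ### Subdividing edges -/

section Subdivide

variable {V : Type} {m : ℕ} {G : SimpleGraph V}

theorem mk_out (e : G.edgeSet) : s((Quot.out e.val).1, (Quot.out e.val).2) = e.val :=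
  Quot.out_eq e.val

theorem adj_out (e : G.edgeSet) : G.Adj (Quot.out e.val).1 (Quot.out e.val).2 := by
  rw [← mem_edgeSet, mk_out]
  exact e.2

theorem subdivPath_zero (e : G.edgeSet) :
    subdivPath m G e 0 = Sum.inl (Quot.out e.val).1 := dif_pos rfl

theorem subdivPath_last (hm : m ≠ 0) (e : G.edgeSet) :
    subdivPath m G e (Fin.last m) = Sum.inl (Quot.out e.val).2 := by
  rw [subdivPath, dif_neg (by exact hm), dif_pos (Fin.val_last m)]

theorem subdivPath_inner (e : G.edgeSet) {k : Fin (m + 1)} (h0 : k.val ≠ 0) (hk : k.val ≠ m) :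
    subdivPath m G e k = Sum.inr (e, ⟨k.val - 1, by omega⟩) := by
  rw [subdivPath, dif_neg h0, dif_neg hk]

theorem subdivPath_succ (e : G.edgeSet) (i : Fin (m - 1)) :
    subdivPath m G e ⟨i.val + 1, by omega⟩ = Sum.inr (e, i) :=
  subdivPath_inner e (Nat.succ_ne_zero _) (by simp only [ne_eq]; omega)

theorem subdivPath_injective (e : G.edgeSet) : Function.Injective (subdivPath m G e) := by
  intro a b h
  have hne := (adj_out e).ne
  apply Fin.ext
  unfold subdivPath at h
  split_ifs at h <;> (simp_all; try omega)

theorem eq_of_subdivPath_eq_inr {e e' : G.edgeSet} {k : Fin (m + 1)} {i : Fin (m - 1)}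
    (h : subdivPath m G e k = Sum.inr (e', i)) : e = e' := by
  unfold subdivPath at h
  split_ifs at h
  exact congrArg Prod.fst (Sum.inr_injective h)

theorem exists_extend_subdivVertex {α : Type*} (hm : m ≠ 0) {φ : V → α}
    {ψ : G.edgeSet → Fin (m + 1) → α} (hfst : ∀ e, ψ e 0 = φ (Quot.out e.val).1)
    (hsnd : ∀ e, ψ e (Fin.last m) = φ (Quot.out e.val).2) :
    ∃ g : SubdivVertex m G → α,
      (∀ v, g (Sum.inl v) = φ v) ∧ ∀ e k, g (subdivPath m G e k) = ψ e k := by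
  refine ⟨Sum.elim φ fun p => ψ p.1 ⟨p.2.val + 1, by omega⟩, fun _ => rfl, fun e k => ?_⟩
  by_cases h0 : k.val = 0
  · obtain rfl : k = 0 := Fin.ext h0
    rw [subdivPath_zero, hfst, Sum.elim_inl]
  by_cases hk : k.val = m
  · obtain rfl : k = Fin.last m := Fin.ext hk
    rw [subdivPath_last hm, hsnd, Sum.elim_inl]
  · rw [subdivPath_inner e h0 hk, Sum.elim_inr]
    exact congrArg (ψ e) (Fin.ext (Nat.sub_add_cancel (Nat.pos_of_ne_zero h0)))

/-- The `j`-th edge of the path that replaces the edge `e`, for `p = (e, j)`. -/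
noncomputable def pathEdge (m : ℕ) (G : SimpleGraph V) (p : G.edgeSet × Fin m) :
    Sym2 (SubdivVertex m G) :=
  s(subdivPath m G p.1 p.2.castSucc, subdivPath m G p.1 p.2.succ)

theorem exists_inr_mem_pathEdge (hm : 2 ≤ m) (p : G.edgeSet × Fin m) :
    ∃ i, Sum.inr (p.1, i) ∈ pathEdge m G p := by
  obtain ⟨e, j⟩ := p
  by_cases hj : j.val = 0
  · refine ⟨⟨0, by omega⟩, Sym2.mem_iff.2 (Or.inr ?_)⟩
    rw [subdivPath_inner e (by simp) (by simp; omega)]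
    simp [hj]
  · refine ⟨⟨j.val - 1, by omega⟩, Sym2.mem_iff.2 (Or.inl ?_)⟩
    rw [subdivPath_inner e (by simpa using hj) (by simp; omega)]
    simp

theorem pathEdge_injective (hm : 2 ≤ m) : Function.Injective (pathEdge m G) := by
  rintro ⟨e, j⟩ ⟨e', j'⟩ h
  obtain rfl : e' = e := by
    obtain ⟨i, hi⟩ := exists_inr_mem_pathEdge hm (e, j)
    rw [h, pathEdge, Sym2.mem_iff] at hi
    rcases hi with hi | hi <;> exact eq_of_subdivPath_eq_inr hi.symm
  have hpos : s(j.castSucc, j.succ) = s(j'.castSucc, j'.succ) :=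
    Sym2.map.injective (subdivPath_injective e') h
  simp only [Sym2.eq_iff, Fin.ext_iff, Fin.val_castSucc, Fin.val_succ] at hpos
  obtain rfl : j = j' := Fin.ext (by omega)
  rfl

theorem pathEdge_not_isDiag (p : G.edgeSet × Fin m) : ¬ (pathEdge m G p).IsDiag := by
  rw [pathEdge, Sym2.mk_isDiag_iff]
  exact fun h => Fin.castSucc_lt_succ.ne (subdivPath_injective _ h)

/-- The spanning subgraph of the subdivision formed by a set `S` of path edges. -/
noncomputable def pathSubgraph (m : ℕ) (G : SimpleGraph V) (S : Set (G.edgeSet × Fin m)) :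
    SimpleGraph (SubdivVertex m G) :=
  fromEdgeSet (pathEdge m G '' S)

theorem edgeSet_pathSubgraph (S : Set (G.edgeSet × Fin m)) :
    (pathSubgraph m G S).edgeSet = pathEdge m G '' S := by
  rw [pathSubgraph, edgeSet_fromEdgeSet, sdiff_eq_left, Set.disjoint_left]
  rintro _ ⟨p, -, rfl⟩ h
  exact pathEdge_not_isDiag p h

theorem pathSubgraph_adj {S : Set (G.edgeSet × Fin m)} {a b : SubdivVertex m G} :
    (pathSubgraph m G S).Adj a b ↔ ∃ p ∈ S, pathEdge m G p = s(a, b) := by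
  rw [← mem_edgeSet, edgeSet_pathSubgraph, Set.mem_image]

theorem edgeSet_subdivide : (subdivide m G).edgeSet = Set.range (pathEdge m G) := by
  ext x
  induction x with | _ a b =>
  simp only [subdivide, mem_edgeSet, iSup_adj, map_adj', pathGraph_adj, Set.mem_range]
  constructor
  · have pathEdge_of_add_one_eq (e : G.edgeSet) {u v : Fin (m + 1)} (h : u.val + 1 = v.val) :
        ∃ p, pathEdge m G p = s(subdivPath m G e u, subdivPath m G e v) :=
      ⟨(e, ⟨u, by omega⟩), by rw [pathEdge, (Fin.ext h : Fin.succ ⟨u, _⟩ = v)]; rfl⟩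
    rintro ⟨e, -, u, v, h | h, rfl, rfl⟩
    · exact pathEdge_of_add_one_eq e h
    · rw [Sym2.eq_swap]
      exact pathEdge_of_add_one_eq e h
  · rintro ⟨⟨e, j⟩, h⟩
    have hne := pathEdge_not_isDiag (e, j)
    rw [h, Sym2.mk_isDiag_iff] at hne
    refine ⟨e, hne, ?_⟩
    rcases Sym2.eq_iff.1 h with h | h
    · exact ⟨_, _, Or.inl (by simp), h⟩
    · exact ⟨_, _, Or.inr (by simp), h.symm⟩

theorem subdivide_eq_pathSubgraph : subdivide m G = pathSubgraph m G Set.univ := by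
  rw [← edgeSet_inj, edgeSet_subdivide, edgeSet_pathSubgraph, Set.image_univ]

theorem pathSubgraph_le_iff (hm : 2 ≤ m) {S S' : Set (G.edgeSet × Fin m)} :
    pathSubgraph m G S ≤ pathSubgraph m G S' ↔ S ⊆ S' := by
  rw [← edgeSet_subset_edgeSet, edgeSet_pathSubgraph, edgeSet_pathSubgraph,
    Set.image_subset_image_iff (pathEdge_injective hm)]

theorem pathSubgraph_injective (hm : 2 ≤ m) : Function.Injective (pathSubgraph m G) :=
  fun _ _ h => subset_antisymm ((pathSubgraph_le_iff hm).1 h.le) ((pathSubgraph_le_iff hm).1 h.ge)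

theorem exists_eq_pathSubgraph {T : SimpleGraph (SubdivVertex m G)} (hT : T ≤ subdivide m G) :
    ∃ S, T = pathSubgraph m G S := by
  rw [← edgeSet_subset_edgeSet, edgeSet_subdivide] at hT
  obtain ⟨S, h⟩ := Set.subset_range_iff_exists_image_eq.1 hT
  exact ⟨S, by rw [← edgeSet_inj, edgeSet_pathSubgraph, h]⟩

theorem pathSubgraph_le_subdivide (hm : 2 ≤ m) (S : Set (G.edgeSet × Fin m)) :
    pathSubgraph m G S ≤ subdivide m G := by
  rw [subdivide_eq_pathSubgraph, pathSubgraph_le_iff hm]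
  exact Set.subset_univ S

theorem eq_of_pathSubgraph_connected {α : Type*} (hm : m ≠ 0) {S : Set (G.edgeSet × Fin m)}
    (hS : (pathSubgraph m G S).Connected) {φ : V → α} {ψ : G.edgeSet → Fin (m + 1) → α}
    (hfst : ∀ e, ψ e 0 = φ (Quot.out e.val).1)
    (hsnd : ∀ e, ψ e (Fin.last m) = φ (Quot.out e.val).2)
    (hstep : ∀ e j, (e, j) ∈ S → ψ e j.castSucc = ψ e j.succ) :
    (∀ v w, φ v = φ w) ∧ ∀ v e k, φ v = ψ e k := by
  obtain ⟨g, hinl, hpath⟩ := exists_extend_subdivVertex hm hfst hsnd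
  have hadj (a b) (hab : (pathSubgraph m G S).Adj a b) : g a = g b := by
    obtain ⟨⟨e, j⟩, hj, h⟩ := pathSubgraph_adj.1 hab
    rcases Sym2.eq_iff.1 h with ⟨rfl, rfl⟩ | ⟨rfl, rfl⟩ <;> rw [hpath, hpath, hstep e j hj]
  have hconst (a b) : g a = g b := eq_of_reachable_of_forall_adj g hadj (hS.preconnected a b)
  exact ⟨fun v w => by rw [← hinl, ← hinl, hconst],
    fun v e k => by rw [← hinl, ← hpath, hconst]⟩

theorem eq_of_notMem_of_connected {S : Set (G.edgeSet × Fin m)}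
    (hS : (pathSubgraph m G S).Connected) {e : G.edgeSet} {j k : Fin m} (hj : (e, j) ∉ S)
    (hk : (e, k) ∉ S) : j = k := by
  wlog hjk : j < k generalizing j k
  · rcases (not_lt.1 hjk).eq_or_lt with h | h
    · exact h.symm
    · exact (this hk hj h).symm
  -- Otherwise the vertices of the path strictly behind the gap `j` and not behind the gap `k`
  -- form a union of components that misses the vertices of `G`.
  have hlabel := (eq_of_pathSubgraph_connected (by omega) hS (φ := fun _ => False)
    (ψ := fun e' t => e' = e ∧ j.castSucc < t ∧ t ≤ k.castSucc)
    (by simp) (fun _ => by simp [Fin.le_def]) ?_).2 (Quot.out e.val).1 e k.castSucc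
  · exact (hlabel.mpr ⟨rfl, hjk, le_rfl⟩).elim
  · intro e' t ht
    refine propext (and_congr_right fun he => ?_)
    subst he
    have htj : t ≠ j := fun h => hj (h ▸ ht)
    have htk : t ≠ k := fun h => hk (h ▸ ht)
    simp only [Fin.lt_def, Fin.le_def, Fin.ext_iff, ne_eq, Fin.val_castSucc, Fin.val_succ] at *
    omega

/-- The subgraph of `G` formed by the edges all of whose path edges lie in `S`. -/
def fullGraph (S : Set (G.edgeSet × Fin m)) : SimpleGraph V where
  Adj a b := ∃ h : G.Adj a b, ∀ j, (⟨s(a, b), h⟩, j) ∈ S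
  symm := ⟨fun a b ⟨h, hS⟩ => ⟨h.symm, by simpa only [Sym2.eq_swap (a := b)] using hS⟩⟩
  loopless := ⟨fun _ ⟨h, _⟩ => h.ne rfl⟩

theorem fullGraph_le (S : Set (G.edgeSet × Fin m)) : fullGraph S ≤ G := fun _ _ h => h.1

theorem fullGraph_mono {S S' : Set (G.edgeSet × Fin m)} (h : S ⊆ S') :
    fullGraph S ≤ fullGraph S' :=
  fun _ _ hab => ⟨hab.1, fun j => h (hab.2 j)⟩

theorem mem_edgeSet_fullGraph {S : Set (G.edgeSet × Fin m)} (e : G.edgeSet) :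
    e.val ∈ (fullGraph S).edgeSet ↔ ∀ j, (e, j) ∈ S := by
  obtain ⟨e, he⟩ := e
  induction e with | _ a b =>
  exact ⟨fun ⟨_, h⟩ => h, fun h => ⟨he, h⟩⟩

theorem fullGraph_connected (hm : m ≠ 0) {S : Set (G.edgeSet × Fin m)}
    (hS : (pathSubgraph m G S).Connected) : (fullGraph S).Connected := by
  classical
  have : Nonempty V := hS.nonempty.elim fun x =>
    x.elim (fun v => ⟨v⟩) fun p => ⟨(Quot.out p.1.val).1⟩
  -- Contract each path with a gap onto the ends of its edge by cutting it at the gap.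
  let component := (fullGraph S).connectedComponentMk
  have hlabel := (eq_of_pathSubgraph_connected hm hS (φ := component)
    (ψ := fun e t => if ∃ j : Fin m, j.castSucc < t ∧ (e, j) ∉ S
      then component (Quot.out e.val).2 else component (Quot.out e.val).1)
    (fun e => if_neg (by simp)) ?_ ?_).1
  · exact ⟨fun v w => ConnectedComponent.exact (hlabel v w)⟩
  · intro e
    split_ifs with hgap
    · rfl
    · have hfull : ∀ j, (e, j) ∈ S := by simpa [Fin.castSucc_lt_last] using hgap
      refine ConnectedComponent.sound (Adj.reachable ?_)
      rwa [← mem_edgeSet, mk_out, mem_edgeSet_fullGraph]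
  · intro e t ht
    congr 1
    refine propext (exists_congr fun j => and_congr_left fun hj => ?_)
    have hjt : j ≠ t := fun h => hj (h ▸ ht)
    simp only [Fin.lt_def, Fin.ext_iff, ne_eq, Fin.val_castSucc, Fin.val_succ] at *
    omega

theorem reachable_subdivPath {S : Set (G.edgeSet × Fin m)} {e : G.edgeSet} {a b : Fin (m + 1)}
    (hab : a ≤ b) (h : ∀ j : Fin m, a ≤ j.castSucc → j.castSucc < b → (e, j) ∈ S) :
    (pathSubgraph m G S).Reachable (subdivPath m G e a) (subdivPath m G e b) := by
  induction b using Fin.induction with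
  | zero => rw [Fin.le_zero_iff.1 hab]
  | succ j ih =>
    rcases hab.eq_or_lt with rfl | hlt
    · exact Reachable.refl _
    · have hle : a ≤ j.castSucc := Fin.le_castSucc_iff.2 hlt
      have hadj : (pathSubgraph m G S).Adj (subdivPath m G e j.castSucc)
          (subdivPath m G e j.succ) :=
        pathSubgraph_adj.2 ⟨(e, j), h j hle Fin.castSucc_lt_succ, rfl⟩
      exact (ih hle fun i hai hij => h i hai (hij.trans Fin.castSucc_lt_succ)).trans
        hadj.reachable

theorem reachable_inl_of_fullGraph_adj (hm : m ≠ 0) {S : Set (G.edgeSet × Fin m)} {a b : V}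
    (hab : (fullGraph S).Adj a b) :
    (pathSubgraph m G S).Reachable (Sum.inl a) (Sum.inl b) := by
  obtain ⟨hG, hS⟩ := hab
  have hpath := reachable_subdivPath (S := S) (e := ⟨s(a, b), hG⟩) (Fin.zero_le (Fin.last m))
    fun j _ _ => hS j
  rw [subdivPath_zero, subdivPath_last hm] at hpath
  rcases Sym2.eq_iff.1 (mk_out ⟨s(a, b), hG⟩) with ⟨ha, hb⟩ | ⟨ha, hb⟩ <;> rw [ha, hb] at hpath
  · exact hpath
  · exact hpath.symm

theorem exists_reachable_inl_subdivPath (hm : m ≠ 0) {S : Set (G.edgeSet × Fin m)}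
    {e : G.edgeSet} (he : ∀ j k, (e, j) ∉ S → (e, k) ∉ S → j = k) (t : Fin (m + 1)) :
    ∃ v, (pathSubgraph m G S).Reachable (Sum.inl v) (subdivPath m G e t) := by
  by_cases hgap : ∃ j : Fin m, j.castSucc < t ∧ (e, j) ∉ S
  · obtain ⟨j, hjt, hj⟩ := hgap
    refine ⟨(Quot.out e.val).2, ?_⟩
    rw [← subdivPath_last hm]
    refine (reachable_subdivPath (Fin.le_last t) fun k htk _ => ?_).symm
    by_contra hk
    exact (hjt.trans_le htk).ne (congrArg Fin.castSucc (he j k hj hk))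
  · push Not at hgap
    refine ⟨(Quot.out e.val).1, ?_⟩
    rw [← subdivPath_zero]
    exact reachable_subdivPath (Fin.zero_le t) fun k _ => hgap k

theorem pathSubgraph_connected (hm : m ≠ 0) {S : Set (G.edgeSet × Fin m)}
    (hgap : ∀ e j k, (e, j) ∉ S → (e, k) ∉ S → j = k) (hS : (fullGraph S).Connected) :
    (pathSubgraph m G S).Connected := by
  obtain ⟨v₀⟩ := hS.nonempty
  have reachable_inl (v) : (pathSubgraph m G S).Reachable (Sum.inl v₀) (Sum.inl v) :=
    reachable_of_forall_adj Sum.inl (fun _ _ => reachable_inl_of_fullGraph_adj hm)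
      (hS.preconnected v₀ v)
  refine (connected_iff_exists_forall_reachable _).2 ⟨Sum.inl v₀, ?_⟩
  rintro (v | ⟨e, i⟩)
  · exact reachable_inl v
  · obtain ⟨v, hv⟩ := exists_reachable_inl_subdivPath hm (hgap e) ⟨i.val + 1, by omega⟩
    rw [subdivPath_succ] at hv
    exact (reachable_inl v).trans hv

theorem subdivide_connected (hm : m ≠ 0) (hG : G.Connected) : (subdivide m G).Connected := by
  rw [subdivide_eq_pathSubgraph]
  exact pathSubgraph_connected hm (fun _ _ _ h => absurd (Set.mem_univ _) h)
    (hG.mono fun _ _ h => ⟨h, fun _ => Set.mem_univ _⟩)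

/-- All path edges except, for each edge `e` of `G` outside `T`, the one chosen by `c`. -/
def omitChosen (T : SimpleGraph V) (c : {e : G.edgeSet // e.val ∉ T.edgeSet} → Fin m) :
    Set (G.edgeSet × Fin m) :=
  {p | ∀ h : p.1.val ∉ T.edgeSet, p.2 ≠ c ⟨p.1, h⟩}

section OmitChosen

variable {T : SimpleGraph V} {c : {e : G.edgeSet // e.val ∉ T.edgeSet} → Fin m}

theorem notMem_omitChosen {e : G.edgeSet} {j : Fin m} :
    (e, j) ∉ omitChosen T c ↔ ∃ h : e.val ∉ T.edgeSet, j = c ⟨e, h⟩ := by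
  simp [omitChosen]

theorem fullGraph_omitChosen (hT : T ≤ G) : fullGraph (omitChosen T c) = T := by
  ext a b
  refine ⟨fun hab => ?_, fun hab => ⟨hT hab, fun j h => absurd hab h⟩⟩
  by_contra! h
  rw [← mem_edgeSet] at h
  exact hab.2 (c ⟨⟨s(a, b), hab.1⟩, h⟩) h rfl

theorem pathSubgraph_omitChosen_connected (hm : m ≠ 0) (hTG : T ≤ G) (hT : T.Connected) :
    (pathSubgraph m G (omitChosen T c)).Connected := by
  refine pathSubgraph_connected hm (fun e j k hj hk => ?_) (by rwa [fullGraph_omitChosen hTG])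
  obtain ⟨_, rfl⟩ := notMem_omitChosen.1 hj
  obtain ⟨_, rfl⟩ := notMem_omitChosen.1 hk
  rfl

theorem pathSubgraph_omitChosen_isTree (hm : 2 ≤ m) (hTG : T ≤ G) (hT : T.IsTree) :
    (pathSubgraph m G (omitChosen T c)).IsTree := by
  rw [isTree_iff_minimal_connected] at hT ⊢
  refine ⟨pathSubgraph_omitChosen_connected (by omega) hTG hT.prop, fun T' hT' hle => ?_⟩
  obtain ⟨S, rfl⟩ := exists_eq_pathSubgraph (hle.trans (pathSubgraph_le_subdivide hm _))
  have hS : S ⊆ omitChosen T c := (pathSubgraph_le_iff hm).1 hle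
  have hfull : T ≤ fullGraph S := hT.le_of_le (fullGraph_connected (by omega) hT') <| by
    simpa only [fullGraph_omitChosen hTG] using fullGraph_mono hS
  refine (pathSubgraph_le_iff hm).2 ?_
  rintro ⟨e, j⟩ hj
  by_cases he : e.val ∈ T.edgeSet
  · exact (mem_edgeSet_fullGraph e).1 (edgeSet_mono hfull he) j
  · by_contra hjS
    have hc : (e, c ⟨e, he⟩) ∉ S := fun h => hS h he rfl
    exact hj he (eq_of_notMem_of_connected hT' hjS hc)

theorem exists_omitChosen_subset (hm : m ≠ 0) {S : Set (G.edgeSet × Fin m)}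
    (hS : (pathSubgraph m G S).Connected) :
    ∃ T ≤ G, T.IsTree ∧
      ∃ c : {e : G.edgeSet // e.val ∉ T.edgeSet} → Fin m, omitChosen T c ⊆ S := by
  obtain ⟨T, hTS, hT⟩ := (fullGraph_connected hm hS).exists_isTree_le
  have hgap (e : {e : G.edgeSet // e.val ∉ T.edgeSet}) : ∃ j, ∀ k, k ≠ j → (e.val, k) ∈ S := by
    by_cases h : ∃ j, (e.val, j) ∉ S
    · obtain ⟨j, hj⟩ := h
      exact ⟨j, fun k hkj => by_contra fun hk => hkj (eq_of_notMem_of_connected hS hk hj)⟩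
    · push Not at h
      exact ⟨⟨0, Nat.pos_of_ne_zero hm⟩, fun k _ => h k⟩
  choose c hc using hgap
  refine ⟨T, hTS.trans (fullGraph_le S), hT, c, ?_⟩
  rintro ⟨e, j⟩ hj
  by_cases he : e.val ∈ T.edgeSet
  · exact (mem_edgeSet_fullGraph e).1 (edgeSet_mono hTS he) j
  · exact hc ⟨e, he⟩ j (hj he)

end OmitChosen

/-- The spanning tree of the subdivision obtained from a spanning tree `T` of `G` by subdividing
the edges of `T` and omitting one path edge over each of the other edges of `G`. -/
noncomputable def subdivideTree (hm : 2 ≤ m) (G : SimpleGraph V)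
    (x : (T : SpanningTree G) × ({e : G.edgeSet // e.val ∉ T.val.edgeSet} → Fin m)) :
    SpanningTree (subdivide m G) :=
  ⟨pathSubgraph m G (omitChosen x.1.1 x.2), pathSubgraph_le_subdivide hm _,
    pathSubgraph_omitChosen_isTree hm x.1.2.1 x.1.2.2⟩

theorem subdivideTree_injective (hm : 2 ≤ m) (G : SimpleGraph V) :
    Function.Injective (subdivideTree hm G) := by
  rintro ⟨⟨T, hTG, hT⟩, c⟩ ⟨⟨T', hTG', hT'⟩, c'⟩ h
  have hS : omitChosen T c = omitChosen T' c' :=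
    pathSubgraph_injective hm (congrArg Subtype.val h)
  obtain rfl : T = T' :=
    (fullGraph_omitChosen hTG).symm.trans <|
      (congrArg fullGraph hS).trans (fullGraph_omitChosen hTG')
  obtain rfl : c = c' := by
    funext ⟨e, he⟩
    have hc : (e, c ⟨e, he⟩) ∉ omitChosen T c' := hS ▸ notMem_omitChosen.2 ⟨he, rfl⟩
    exact (notMem_omitChosen.1 hc).2
  rfl

theorem subdivideTree_surjective (hm : 2 ≤ m) (G : SimpleGraph V) :
    Function.Surjective (subdivideTree hm G) := by
  rintro ⟨T', hT'G, hT'⟩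
  obtain ⟨S, rfl⟩ := exists_eq_pathSubgraph hT'G
  rw [isTree_iff_minimal_connected] at hT'
  obtain ⟨T, hTG, hT, c, hc⟩ := exists_omitChosen_subset (by omega) hT'.prop
  have hle := (pathSubgraph_le_iff hm).2 hc
  exact ⟨⟨⟨T, hTG, hT⟩, c⟩, Subtype.ext (hT'.eq_of_le
    (pathSubgraph_omitChosen_connected (by omega) hTG hT.connected) hle)⟩

theorem card_edges_notMem_tree [Finite V] {T : SimpleGraph V} (hTG : T ≤ G) (hT : T.IsTree) :
    Nat.card {e : G.edgeSet // e.val ∉ T.edgeSet} = Nat.card G.edgeSet + 1 - Nat.card V := by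
  classical
  have hsplit := Nat.card_congr (Equiv.sumCompl fun e : G.edgeSet => e.val ∈ T.edgeSet)
  rw [Nat.card_sum] at hsplit
  have hmem : Nat.card {e : G.edgeSet // e.val ∈ T.edgeSet} = Nat.card T.edgeSet :=
    Nat.card_congr (Equiv.subtypeSubtypeEquivSubtype fun h => edgeSet_mono hTG h)
  have htree := (isTree_iff_connected_and_card.1 hT).2
  omega

theorem numSpanningTrees_subdivide [Finite V] (hm : 2 ≤ m) (G : SimpleGraph V) :
    numSpanningTrees (subdivide m G) =
      m ^ (Nat.card G.edgeSet + 1 - Nat.card V) * numSpanningTrees G := by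
  have := Fintype.ofFinite (SpanningTree G)
  rw [numSpanningTrees_eq_natCard, numSpanningTrees_eq_natCard,
    ← Nat.card_congr (Equiv.ofBijective (subdivideTree hm G)
      ⟨subdivideTree_injective hm G, subdivideTree_surjective hm G⟩), Nat.card_sigma]
  simp only [Nat.card_fun, Nat.card_fin]
  rw [Finset.sum_congr rfl fun T _ => by rw [card_edges_notMem_tree T.2.1 T.2.2],
    Finset.sum_const, Finset.card_univ, smul_eq_mul, mul_comm,
    Nat.card_eq_fintype_card (α := SpanningTree G)]

theorem natCard_subdivVertex [Finite V] (m : ℕ) (G : SimpleGraph V) :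
    Nat.card (SubdivVertex m G) = Nat.card V + Nat.card G.edgeSet * (m - 1) := by
  rw [Nat.card_sum, Nat.card_prod, Nat.card_fin]

theorem card_edgeSet_subdivide (hm : 2 ≤ m) (G : SimpleGraph V) :
    Nat.card (subdivide m G).edgeSet = Nat.card G.edgeSet * m := by
  rw [edgeSet_subdivide, Nat.card_range_of_injective (pathEdge_injective hm), Nat.card_prod,
    Nat.card_fin]

end Subdivide

/-! ### Parent functions -/

section Parent

variable {W : Type}

/-- The graph on `W` and the additional root `Sum.inr ()` whose edges join every `w : W` to its
parent `p w`. -/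
def parentGraph (p : W → W ⊕ Unit) : SimpleGraph (W ⊕ Unit) :=
  fromEdgeSet (Set.range fun w => s(Sum.inl w, p w))

/-- A parent function reaches the root if iterating it leads from every vertex to the root; over a
finite type, it then describes a rooted tree. -/
def ReachesRoot (p : W → W ⊕ Unit) : Prop :=
  WellFounded fun u w => p w = Sum.inl u

theorem ReachesRoot.adj {p : W → W ⊕ Unit} (h : ReachesRoot p) (w : W) :
    (parentGraph p).Adj (Sum.inl w) (p w) :=
  (fromEdgeSet_adj _).2 ⟨⟨w, rfl⟩, fun hw => h.asymmetric _ _ hw.symm hw.symm⟩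

theorem ReachesRoot.connected {p : W → W ⊕ Unit} (h : ReachesRoot p) :
    (parentGraph p).Connected := by
  refine (connected_iff_exists_forall_reachable _).2 ⟨Sum.inr (), ?_⟩
  rintro (w | ⟨⟩)
  · induction w using h.induction with | _ w ih =>
    refine Reachable.trans ?_ (h.adj w).symm.reachable
    rcases hw : p w with u | ⟨⟩
    · exact ih u hw
    · exact Reachable.refl _
  · exact Reachable.refl _

theorem card_edgeSet_parentGraph_le [Finite W] (p : W → W ⊕ Unit) :
    Nat.card (parentGraph p).edgeSet ≤ Nat.card W := by
  rw [parentGraph, edgeSet_fromEdgeSet]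
  exact (Nat.card_mono (Set.finite_range _) Set.sdiff_subset).trans (Finite.card_range_le _)

theorem ReachesRoot.isTree [Finite W] {p : W → W ⊕ Unit} (h : ReachesRoot p) :
    (parentGraph p).IsTree := by
  refine isTree_iff_connected_and_card.2 ⟨h.connected, le_antisymm ?_
    h.connected.card_vert_le_card_edgeSet_add_one⟩
  rw [Nat.card_sum, Nat.card_unique (α := Unit)]
  exact Nat.succ_le_succ (card_edgeSet_parentGraph_le p)

theorem ReachesRoot.eq_of_parentGraph_eq {p q : W → W ⊕ Unit} (hp : ReachesRoot p)
    (h : parentGraph p = parentGraph q) : p = q := by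
  funext w
  induction w using hp.induction with | _ w ih =>
  have hadj := hp.adj w
  rw [h, parentGraph, fromEdgeSet_adj] at hadj
  obtain ⟨⟨u, hu⟩, -⟩ := hadj
  rcases Sym2.eq_iff.1 hu with ⟨huw, hq⟩ | ⟨hpw, hq⟩
  · cases huw
    exact hq.symm
  · exact absurd ((ih u hpw.symm).trans hq) fun hpu => hp.asymmetric _ _ hpw.symm hpu

theorem parentGraph_le {G : SimpleGraph (W ⊕ Unit)} {p : W → W ⊕ Unit}
    (hp : ∀ w, G.Adj (Sum.inl w) (p w)) : parentGraph p ≤ G := by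
  rw [← edgeSet_subset_edgeSet, parentGraph, edgeSet_fromEdgeSet]
  refine Set.sdiff_subset.trans ?_
  rintro _ ⟨w, rfl⟩
  exact hp w

theorem exists_adj_dist_lt {V : Type*} {G : SimpleGraph V} (hG : G.Connected) {v r : V}
    (h : v ≠ r) : ∃ u, G.Adj v u ∧ G.dist u r < G.dist v r := by
  obtain ⟨q, hq⟩ := (hG.preconnected v r).exists_walk_length_eq_dist
  cases q with
  | nil => exact absurd rfl h
  | cons hadj q' =>
    refine ⟨_, hadj, ?_⟩
    rw [← hq, Walk.length_cons]
    exact Nat.lt_succ_of_le (dist_le q')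

theorem exists_parentGraph_eq {T : SimpleGraph (W ⊕ Unit)} (hT : T.IsTree) :
    ∃ p, ReachesRoot p ∧ (∀ w, T.Adj (Sum.inl w) (p w)) ∧ parentGraph p = T := by
  choose p hadj hlt using fun w : W => exists_adj_dist_lt hT.connected (Sum.inl_ne_inr (b := ()))
  have hp : ReachesRoot p :=
    (measure fun w => T.dist (Sum.inl w) (Sum.inr ())).wf.mono fun u w huw =>
      (congrArg (fun x => T.dist x (Sum.inr ())) huw).ge.trans_lt (hlt w)
  have hle := parentGraph_le hadj
  exact ⟨p, hp, hadj, (isTree_iff_minimal_connected.1 hT).eq_of_le hp.connected hle⟩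

theorem numSpanningTrees_eq_card_parent [Finite W] (G : SimpleGraph (W ⊕ Unit)) :
    numSpanningTrees G =
      Nat.card {p : W → W ⊕ Unit // (∀ w, G.Adj (Sum.inl w) (p w)) ∧ ReachesRoot p} := by
  rw [numSpanningTrees_eq_natCard]
  refine (Nat.card_congr (Equiv.ofBijective
    (fun p => ⟨parentGraph p.1, parentGraph_le p.2.1, p.2.2.isTree⟩) ⟨fun p q h => ?_, ?_⟩)).symm
  · exact Subtype.ext (p.2.2.eq_of_parentGraph_eq (congrArg Subtype.val h))
  · rintro ⟨T, hTG, hT⟩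
    obtain ⟨p, hp, hadj, rfl⟩ := exists_parentGraph_eq hT
    exact ⟨⟨p, fun w => hTG (hadj w), hp⟩, rfl⟩

end Parent

/-! ### Cyclic words and the transfer matrix -/

section CyclicWords

open Matrix

variable {A : Type*} [Fintype A] [DecidableEq A]

theorem matrix_pow_succ_apply {R : Type*} [CommSemiring R] (M : Matrix A A R) (k : ℕ) (a b : A) :
    (M ^ (k + 1)) a b =
      ∑ g : Fin k → A, ∏ i : Fin (k + 1),
        M (Fin.cons (α := fun _ => A) a g i) (Fin.snoc (α := fun _ => A) g b i) := by
  induction k generalizing a with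
  | zero => simp [Fin.snoc]
  | succ k ih =>
    rw [pow_succ', mul_apply, ← (Fin.consEquiv fun _ : Fin (k + 1) => A).sum_comp,
      Fintype.sum_prod_type]
    refine Finset.sum_congr rfl fun c _ => ?_
    rw [ih, Finset.mul_sum]
    refine Finset.sum_congr rfl fun g _ => ?_
    change _ = ∏ i : Fin (k + 2), M (Fin.cons (α := fun _ => A) a
      (Fin.cons (α := fun _ => A) c g) i)
      (Fin.snoc (α := fun _ => A) (Fin.cons (α := fun _ => A) c g) b i)
    rw [Fin.prod_univ_succ (n := k + 1), ← Fin.cons_snoc_eq_snoc_cons]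
    simp only [Fin.cons_zero, Fin.cons_succ]

theorem trace_pow_succ {R : Type*} [CommSemiring R] (M : Matrix A A R) (k : ℕ) :
    (M ^ (k + 1)).trace = ∑ f : Fin (k + 1) → A, ∏ i, M (f i) (f (i + 1)) := by
  rw [← (Fin.consEquiv fun _ : Fin (k + 1) => A).sum_comp, Fintype.sum_prod_type, trace]
  refine Finset.sum_congr rfl fun a _ => ?_
  rw [diag_apply, matrix_pow_succ_apply]
  refine Finset.sum_congr rfl fun g _ => Finset.prod_congr rfl fun i _ => ?_
  congr 1
  induction i using Fin.lastCases with
  | last => simp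
  | cast i => simp [Fin.consEquiv_apply, Fin.coeSucc_eq_succ]

/-- The 0-1 matrix of a relation; the traces of its powers count the cyclic words in which any two
consecutive letters are related. -/
def transferMatrix (r : A → A → Prop) [DecidableRel r] : Matrix A A ℕ :=
  of fun a b => if r a b then 1 else 0

theorem ncard_cyclic_words (r : A → A → Prop) [DecidableRel r] (k : ℕ) :
    {f : Fin (k + 1) → A | ∀ i, r (f i) (f (i + 1))}.ncard =
      (transferMatrix r ^ (k + 1)).trace := by
  rw [trace_pow_succ, Set.ncard_eq_toFinset_card', Set.toFinset_ofPred, Finset.card_filter]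
  simp only [transferMatrix, of_apply, Finset.prod_boole, Finset.mem_univ, true_imp_iff]

end CyclicWords

/-! ### The wheel -/

section Wheel

theorem wheel_adj_inl_inl {n : ℕ} (i j : Fin n) :
    (wheel n).Adj (Sum.inl i) (Sum.inl j) ↔ (cycleGraph n).Adj i j := by
  simp [wheel]

theorem wheel_adj_inl_inr {n : ℕ} (i : Fin n) (u : Unit) :
    (wheel n).Adj (Sum.inl i) (Sum.inr u) := by
  simp [wheel]

theorem wheel_connected (n : ℕ) : (wheel n).Connected := by
  refine (connected_iff_exists_forall_reachable _).2 ⟨Sum.inr (), ?_⟩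
  rintro (i | ⟨⟩)
  · exact (wheel_adj_inl_inr i ()).symm.reachable
  · exact Reachable.refl _

variable {k : ℕ}

theorem fin_add_one_ne_sub_one (i : Fin (k + 3)) : i + 1 ≠ i - 1 := by
  intro h
  have htwo : (1 : Fin (k + 3)) + 1 = 0 := by
    have := congrArg (fun j => j - i + 1) h
    simpa using this
  exact absurd (congrArg Fin.val htwo) (by simp [Fin.val_add, Nat.mod_eq_of_lt])

open Fin.CommRing in
theorem fin_forall_of_add_one {P : Fin (k + 1) → Prop} (h : ∀ i, P i → P (i + 1))
    {i : Fin (k + 1)} (hi : P i) (j : Fin (k + 1)) : P j := by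
  have forall_add (t : ℕ) : P (i + (t : Fin (k + 1))) := by
    induction t with
    | zero => rwa [Nat.cast_zero, add_zero]
    | succ t ih =>
      rw [Nat.cast_succ, ← add_assoc]
      exact h _ ih
  have := forall_add (j - i).val
  rwa [Fin.cast_val_eq_self, add_sub_cancel] at this

theorem fin_forall_of_sub_one {P : Fin (k + 1) → Prop} (h : ∀ i, P i → P (i - 1))
    {i : Fin (k + 1)} (hi : P i) (j : Fin (k + 1)) : P j := by
  have := fin_forall_of_add_one (P := fun i => P (-i))
    (fun i hi => by rw [neg_add']; exact h _ hi) (i := -i) (by rwa [neg_neg]) (-j)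
  rwa [neg_neg] at this

theorem wheel_adj_inl_inl_iff {i j : Fin (k + 3)} :
    (wheel (k + 3)).Adj (Sum.inl i) (Sum.inl j) ↔ j = i + 1 ∨ j = i - 1 := by
  rw [wheel_adj_inl_inl, cycleGraph_adj, or_comm, sub_eq_iff_eq_add', sub_eq_iff_eq_add',
    eq_sub_iff_add_eq, eq_comm (a := i)]

/-- The neighbours of a rim vertex of a wheel: the hub, the next and the previous rim vertex. -/
inductive ParentChoice
  | hub
  | next
  | prev
  deriving DecidableEq

open ParentChoice

instance : Fintype ParentChoice := ⟨{hub, next, prev}, by rintro (_ | _ | _) <;> decide⟩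

/-- The parent of the rim vertex `i` selected by a letter. -/
def rimParent (i : Fin (k + 3)) : ParentChoice → Fin (k + 3) ⊕ Unit
  | hub => Sum.inr ()
  | next => Sum.inl (i + 1)
  | prev => Sum.inl (i - 1)

theorem rimParent_injective (i : Fin (k + 3)) : Function.Injective (rimParent i) := by
  have := fin_add_one_ne_sub_one i
  rintro (_ | _ | _) (_ | _ | _) h <;> simp_all [rimParent, eq_comm]

theorem range_rimParent (i : Fin (k + 3)) :
    Set.range (rimParent i) = {v | (wheel (k + 3)).Adj (Sum.inl i) v} := by
  ext (j | ⟨⟩)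
  · rw [Set.mem_ofPred_eq, wheel_adj_inl_inl_iff]
    constructor
    · rintro ⟨_ | _ | _, h⟩ <;> simp_all [rimParent]
    · rintro (rfl | rfl)
      exacts [⟨next, rfl⟩, ⟨prev, rfl⟩]
  · exact iff_of_true ⟨hub, rfl⟩ (wheel_adj_inl_inr i ())

theorem rimParent_eq_inl {i j : Fin (k + 3)} {c : ParentChoice} :
    rimParent i c = Sum.inl j ↔ c = next ∧ i + 1 = j ∨ c = prev ∧ i - 1 = j := by
  cases c <;> simp [rimParent]

/-- Two consecutive rim vertices do not choose each other as parents. -/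
abbrev Compatible (a b : ParentChoice) : Prop := ¬ (a = next ∧ b = prev)

theorem ReachesRoot.compatible {f : Fin (k + 3) → ParentChoice}
    (h : ReachesRoot fun i => rimParent i (f i)) (i : Fin (k + 3)) :
    Compatible (f i) (f (i + 1)) := fun ⟨hnext, hprev⟩ =>
  h.asymmetric i (i + 1) (rimParent_eq_inl.2 (Or.inr ⟨hprev, add_sub_cancel_right i 1⟩))
    (rimParent_eq_inl.2 (Or.inl ⟨hnext, rfl⟩))

theorem not_reachesRoot_const {c : ParentChoice} (hc : c ≠ hub) :
    ¬ ReachesRoot fun i : Fin (k + 3) => rimParent i c := by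
  intro h
  obtain ⟨i, -, hmin⟩ := h.has_min Set.univ ⟨0, trivial⟩
  cases c with
  | hub => exact hc rfl
  | next => exact hmin (i + 1) trivial rfl
  | prev => exact hmin (i - 1) trivial rfl

theorem const_of_not_reachesRoot {f : Fin (k + 3) → ParentChoice}
    (hf : ∀ i, Compatible (f i) (f (i + 1))) (h : ¬ ReachesRoot fun i => rimParent i (f i)) :
    (∀ i, f i = next) ∨ ∀ i, f i = prev := by
  -- A vertex from which the root is not reached passes this on to its parent, and by compatibility
  -- the parent repeats its choice.
  let Stuck (i : Fin (k + 3)) : Prop := ¬ Acc (fun u w => rimParent w (f w) = Sum.inl u) i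
  have stuck_parent (i) (hi : Stuck i) :
      f i = next ∧ Stuck (i + 1) ∨ f i = prev ∧ Stuck (i - 1) := by
    obtain ⟨j, hj, hij⟩ := exists_not_acc_lt_of_not_acc hi
    rcases rimParent_eq_inl.1 hij with ⟨hnext, rfl⟩ | ⟨hprev, rfl⟩
    exacts [Or.inl ⟨hnext, hj⟩, Or.inr ⟨hprev, hj⟩]
  obtain ⟨i, hi⟩ : ∃ i, Stuck i := not_forall.1 fun hacc => h ⟨hacc⟩
  rcases stuck_parent i hi with ⟨hnext, -⟩ | ⟨hprev, -⟩
  · refine Or.inl fun j => (fin_forall_of_add_one (P := fun i => f i = next ∧ Stuck i)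
      (fun i ⟨hnext, hi⟩ => ?_) ⟨hnext, hi⟩ j).1
    have hi' : Stuck (i + 1) := by simpa [hnext] using stuck_parent i hi
    exact ⟨(stuck_parent _ hi').elim And.left fun h => absurd ⟨hnext, h.1⟩ (hf i), hi'⟩
  · refine Or.inr fun j => (fin_forall_of_sub_one (P := fun i => f i = prev ∧ Stuck i)
      (fun i ⟨hprev, hi⟩ => ?_) ⟨hprev, hi⟩ j).1
    have hi' : Stuck (i - 1) := by simpa [hprev] using stuck_parent i hi
    refine ⟨(stuck_parent _ hi').elim (fun h => ?_) And.left, hi'⟩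
    exact absurd ⟨h.1, by rwa [sub_add_cancel]⟩ (hf (i - 1))

theorem setOf_reachesRoot_rimParent :
    {f : Fin (k + 3) → ParentChoice | ReachesRoot fun i => rimParent i (f i)} =
      {f | ∀ i, Compatible (f i) (f (i + 1))} \ {fun _ => next, fun _ => prev} := by
  ext f
  constructor
  · refine fun h => ⟨h.compatible, ?_⟩
    rintro (rfl | rfl)
    exacts [not_reachesRoot_const (by decide) h, not_reachesRoot_const (by decide) h]
  · rintro ⟨hf, hconst⟩
    by_contra h
    exact hconst ((const_of_not_reachesRoot hf h).imp funext funext)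

theorem numSpanningTrees_wheel_eq_ncard (k : ℕ) :
    numSpanningTrees (wheel (k + 3)) =
      {f : Fin (k + 3) → ParentChoice | ReachesRoot fun i => rimParent i (f i)}.ncard := by
  rw [numSpanningTrees_eq_card_parent]
  refine (Nat.card_congr (Equiv.ofBijective (fun f => ⟨fun i => rimParent i (f.1 i),
    fun i => (range_rimParent i).le ⟨f.1 i, rfl⟩, f.2⟩) ⟨fun f g h => ?_, ?_⟩)).symm
  · exact Subtype.ext (funext fun i =>
      rimParent_injective i (congrFun (congrArg Subtype.val h) i))
  · rintro ⟨p, hadj, hp⟩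
    choose f hf using fun i => (range_rimParent i).ge (hadj i)
    obtain rfl : (fun i => rimParent i (f i)) = p := funext hf
    exact ⟨⟨f, hp⟩, rfl⟩

theorem numSpanningTrees_wheel_add_two (k : ℕ) :
    numSpanningTrees (wheel (k + 3)) + 2 = (transferMatrix Compatible ^ (k + 3)).trace := by
  have hne : (fun _ => next : Fin (k + 3) → ParentChoice) ≠ fun _ => prev := fun h =>
    absurd (congrFun h 0) (by decide)
  have hsubset : {fun _ => next, fun _ => prev} ⊆
      {f : Fin (k + 3) → ParentChoice | ∀ i, Compatible (f i) (f (i + 1))} := by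
    rintro _ (rfl | rfl) <;> simp [Compatible]
  have hcount := Set.ncard_sdiff_add_ncard_of_subset hsubset
  rwa [Set.ncard_pair hne, ncard_cyclic_words, ← setOf_reachesRoot_rimParent,
    ← numSpanningTrees_wheel_eq_ncard] at hcount

open Real in
theorem trace_transferMatrix_pow (n : ℕ) :
    ((transferMatrix Compatible ^ (n + 1)).trace : ℝ) =
      goldenRatio ^ (2 * (n + 1)) + goldenConj ^ (2 * (n + 1)) := by
  set M := transferMatrix Compatible with hM
  have hsum := goldenRatio_add_goldenConj
  have hφ := goldenRatio_sq
  have hψ := goldenConj_sq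
  have trace_rec (j : ℕ) : (M ^ (j + 3)).trace + (M ^ (j + 1)).trace = 3 * (M ^ (j + 2)).trace := by
    have hcubic : M ^ 3 + M = 3 • M ^ 2 := by rw [hM]; decide
    have hpow : M ^ (j + 3) + M ^ (j + 1) = 3 • M ^ (j + 2) := by
      rw [pow_add, pow_add _ j 1, pow_add _ j 2, pow_one, ← mul_add, hcubic, mul_smul_comm]
    rw [← Matrix.trace_add, hpow, Matrix.trace_smul, smul_eq_mul]
  have power_rec {x : ℝ} (hx : x ^ 2 = x + 1) (j : ℕ) :
      x ^ (2 * (j + 3)) + x ^ (2 * (j + 1)) = 3 * x ^ (2 * (j + 2)) := by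
    linear_combination x ^ (2 * j + 2) * (x ^ 2 + x - 1) * hx
  induction n using Nat.twoStepInduction with
  | zero =>
    have htrace : (M ^ 1).trace = 3 := by rw [hM]; decide
    rw [zero_add, htrace]
    linear_combination -hφ - hψ - hsum
  | one =>
    have htrace : (M ^ 2).trace = 7 := by rw [hM]; decide
    rw [one_add_one_eq_two, htrace]
    linear_combination -(goldenRatio ^ 2 + goldenRatio + 2) * hφ
      - (goldenConj ^ 2 + goldenConj + 2) * hψ - 3 * hsum
  | more j ih₁ ih₂ =>
    have h := trace_rec j
    rify at h
    linear_combination h - power_rec hφ j - power_rec hψ j - ih₁ + 3 * ih₂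

theorem coeffD_eq (n : ℕ) : coeffD n = Real.goldenConj ^ (2 * n) := by
  have hcos : Real.cos (2 * Real.pi * n) = 1 := by
    rw [mul_comm, Real.cos_nat_mul_two_pi]
  have hφ : √5 + 1 = 2 * Real.goldenRatio := by
    rw [Real.goldenRatio]
    ring
  have hψ : Real.goldenConj ^ 2 = (Real.goldenRatio ^ 2)⁻¹ := by
    rw [← inv_pow, Real.inv_goldenRatio, neg_sq]
  have hzpow : (√5 + 1) ^ (-(2 * n : ℤ)) = ((√5 + 1) ^ (2 * n))⁻¹ := by
    rw [zpow_neg]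
    exact_mod_cast rfl
  rw [coeffD, hcos, mul_one, hzpow, hφ, pow_mul, pow_mul, hψ, ← inv_pow, ← mul_pow]
  congr 1
  rw [mul_pow, mul_inv, ← mul_assoc]
  norm_num

theorem numSpanningTrees_wheel {n : ℕ} (hn : 3 ≤ n) :
    (numSpanningTrees (wheel n) : ℝ) = (1 / 2 * (√5 + 1)) ^ (2 * n) - 2 + coeffD n := by
  obtain ⟨k, rfl⟩ := Nat.exists_eq_add_of_le' hn
  have htrace := numSpanningTrees_wheel_add_two k
  rify at htrace
  rw [trace_transferMatrix_pow (k + 2), ← coeffD_eq,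
    show Real.goldenRatio = 1 / 2 * (√5 + 1) by rw [Real.goldenRatio]; ring] at htrace
  linear_combination htrace

/-- The edges of the wheel, listed as its spokes and its rim edges. -/
def wheelEdge : Fin (k + 3) ⊕ Fin (k + 3) → Sym2 (Fin (k + 3) ⊕ Unit) :=
  Sum.elim (fun i => s(Sum.inl i, Sum.inr ())) fun i => s(Sum.inl i, Sum.inl (i + 1))

theorem wheelEdge_injective : Function.Injective (wheelEdge (k := k)) := by
  rintro (i | i) (j | j) h <;>
    simp only [wheelEdge, Sum.elim_inl, Sum.elim_inr, Sym2.eq_iff, Sum.inl.injEq, reduceCtorEq,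
      and_true, and_false, false_and, or_false] at h
  · rw [h]
  · rcases h with ⟨rfl, -⟩ | ⟨rfl, h⟩
    · rfl
    · exact absurd (h.trans (add_sub_cancel_right j 1).symm) (fin_add_one_ne_sub_one (j + 1))

theorem range_wheelEdge : Set.range (wheelEdge (k := k)) = (wheel (k + 3)).edgeSet := by
  ext e
  constructor
  · rintro ⟨i | i, rfl⟩
    · exact wheel_adj_inl_inr i ()
    · exact wheel_adj_inl_inl_iff.2 (Or.inl rfl)
  · induction e with | _ a b =>
    intro h
    rw [mem_edgeSet] at h
    rcases a with i | ⟨⟩ <;> rcases b with j | ⟨⟩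
    · rcases wheel_adj_inl_inl_iff.1 h with rfl | rfl
      · exact ⟨Sum.inr i, rfl⟩
      · exact ⟨Sum.inr (i - 1), by simp [wheelEdge]⟩
    · exact ⟨Sum.inl i, rfl⟩
    · exact ⟨Sum.inl j, Sym2.eq_swap⟩
    · exact absurd rfl h.ne

theorem card_edgeSet_wheel {n : ℕ} (hn : 3 ≤ n) : Nat.card (wheel n).edgeSet = 2 * n := by
  obtain ⟨k, rfl⟩ := Nat.exists_eq_add_of_le' hn
  rw [← range_wheelEdge, Nat.card_range_of_injective wheelEdge_injective, Nat.card_sum,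
    Nat.card_fin, two_mul]

end Wheel

/-! ### Linear recurrences and the Stolz–Cesàro theorem -/

section Asymptotics

open Filter Topology

theorem abs_div_sub_le_of_linear_recurrence {a b c d ρ v v' e e' : ℝ} (ha : 0 < a) (hb : 0 ≤ b)
    (hv : 0 < v) (he : 0 ≤ e) (hv' : v' = a * v + b * e) (he' : e' = c * v + d * e)
    (hρ : c + d * ρ = (a + b * ρ) * ρ) :
    |e' / v' - ρ| ≤ |d - b * ρ| / a * |e / v - ρ| := by
  have hle : a * v ≤ v' := by
    rw [hv']
    exact le_add_of_nonneg_right (mul_nonneg hb he)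
  have hpos : 0 < v' := (mul_pos ha hv).trans_le hle
  have hratio : |v / v'| ≤ a⁻¹ := by
    rw [abs_of_pos (div_pos hv hpos), div_le_iff₀ hpos, inv_mul_eq_div, le_div_iff₀' ha]
    exact hle
  have hstep : e' / v' - ρ = (d - b * ρ) * (v / v') * (e / v - ρ) := by
    field_simp
    rw [he', hv']
    linear_combination v * hρ
  rw [hstep, abs_mul, abs_mul, div_eq_mul_inv |d - b * ρ| a]
  gcongr

theorem tendsto_div_of_linear_recurrence {a b c d ρ : ℝ} {v e : ℕ → ℝ} (ha : 0 < a) (hb : 0 ≤ b)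
    (hv : ∀ i, 0 < v i) (he : ∀ i, 0 ≤ e i) (hv_succ : ∀ i, v (i + 1) = a * v i + b * e i)
    (he_succ : ∀ i, e (i + 1) = c * v i + d * e i) (hρ : c + d * ρ = (a + b * ρ) * ρ)
    (hlt : |d - b * ρ| < a) : Tendsto (fun i => e i / v i) atTop (𝓝 ρ) := by
  have hq : 0 ≤ |d - b * ρ| / a := by positivity
  have hbound (i : ℕ) : |e i / v i - ρ| ≤ (|d - b * ρ| / a) ^ i * |e 0 / v 0 - ρ| :=
    le_geom (u := fun i => |e i / v i - ρ|) hq i fun k _ =>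
      abs_div_sub_le_of_linear_recurrence ha hb (hv k) (he k) (hv_succ k) (he_succ k) hρ
  have hgeom := (tendsto_pow_atTop_nhds_zero_of_lt_one hq ((div_lt_one ha).2 hlt)).mul_const
    |e 0 / v 0 - ρ|
  rw [zero_mul] at hgeom
  exact tendsto_iff_norm_sub_tendsto_zero.2
    (squeeze_zero (fun _ => norm_nonneg _) hbound hgeom)

theorem tendsto_div_of_tendsto_sub_div_sub {u v : ℕ → ℝ} {σ : ℝ} (hv : StrictMono v)
    (hv_top : Tendsto v atTop atTop)
    (h : Tendsto (fun i => (u (i + 1) - u i) / (v (i + 1) - v i)) atTop (𝓝 σ)) :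
    Tendsto (fun i => u i / v i) atTop (𝓝 σ) := by
  have hpos (i : ℕ) : 0 < v (i + 1) - v i := sub_pos.2 (hv i.lt_succ_self)
  let f (i : ℕ) : ℝ := u i - σ * v i
  have hstep : (fun i => f (i + 1) - f i) =o[atTop] fun i => v (i + 1) - v i := by
    refine (Asymptotics.isLittleO_iff_tendsto' (.of_forall fun i hi =>
      absurd hi (hpos i).ne')).2 ?_
    rw [← sub_self σ]
    refine (h.sub_const σ).congr fun i => ?_
    have := (hpos i).ne'
    field_simp
    simp only [f]
    ring
  have hsum := hstep.sum_range (fun i => (hpos i).le) (by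
    simp only [Finset.sum_range_sub]
    exact tendsto_atTop_add_const_right _ _ hv_top)
  simp only [Finset.sum_range_sub] at hsum
  have hconst (x : ℝ) : (fun _ => x) =o[atTop] v :=
    Asymptotics.isLittleO_const_left.2 (Or.inr (tendsto_norm_atTop_atTop.comp hv_top))
  have hf : f =o[atTop] v := by
    have := (hsum.trans_isBigO ((Asymptotics.isBigO_refl v _).sub (hconst (v 0)).isBigO)).add
      (hconst (f 0))
    simpa only [sub_add_cancel] using this
  rw [← zero_add σ]
  refine (hf.tendsto_div_nhds_zero.add_const σ).congr' ?_
  filter_upwards [hv_top.eventually_ne_atTop 0] with i hi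
  simp only [f]
  field_simp
  ring

theorem tendsto_div_of_increments {v e ℓ : ℕ → ℝ} {ρ q L w : ℝ} (hv : StrictMono v)
    (hv_top : Tendsto v atTop atTop) (hpos : ∀ i, 0 < v i)
    (hρ : Tendsto (fun i => e i / v i) atTop (𝓝 ρ))
    (hq : Tendsto (fun i => v i / v (i + 1)) atTop (𝓝 q)) (hq1 : q ≠ 1)
    (hℓ : ∀ i, ℓ (i + 1) = ℓ i + (e (i + 1) - v (i + 1) + 1) * L + v (i + 1) * w) :
    Tendsto (fun i => ℓ i / v i) atTop (𝓝 (((ρ - 1) * L + w) / (1 - q))) := by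
  have hinv : Tendsto (fun i => (v (i + 1))⁻¹) atTop (𝓝 0) :=
    (tendsto_inv_atTop_zero.comp hv_top).comp (tendsto_add_atTop_nat 1)
  have hnum := ((((hρ.comp (tendsto_add_atTop_nat 1)).sub_const 1).add hinv).mul_const L).add_const
    w
  have hquot := hnum.div (hq.const_sub 1) (sub_ne_zero.2 hq1.symm)
  rw [add_zero] at hquot
  refine tendsto_div_of_tendsto_sub_div_sub hv hv_top (hquot.congr fun i => ?_)
  have h1 := hpos (i + 1)
  have hsub : v (i + 1) - v i ≠ 0 := (sub_pos.2 (hv i.lt_succ_self)).ne'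
  have hsub' : 1 - v i / v (i + 1) ≠ 0 := by
    rw [one_sub_div h1.ne']
    exact div_ne_zero hsub h1.ne'
  simp only [Pi.div_apply, Function.comp_apply]
  rw [div_eq_div_iff hsub' hsub, hℓ]
  field_simp
  ring

end Asymptotics

/-! ### The closed form -/

section ClosedForm

variable {n m : ℝ}

theorem zeta_sq (hn : 0 < n) (hm : 1 < m) :
    zeta n m ^ 2 = 6 * (m - 1) * n + (m - 1) ^ 2 + n ^ 2 := by
  have : 0 < m - 1 := sub_pos.2 hm
  exact Real.sq_sqrt (by positivity)

theorem lt_zeta (hn : 0 < n) (hm : 1 < m) : m - 1 + n < zeta n m := by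
  have := mul_pos (sub_pos.2 hm) hn
  exact Real.lt_sqrt_of_sq_lt (by linear_combination 4 * this)

theorem zeta_lt (hn : 0 < n) (hm : 1 < m) : zeta n m < m - 1 + 3 * n := by
  have : 0 < m - 1 := sub_pos.2 hm
  exact (Real.sqrt_lt' (by positivity)).2 (by linear_combination 8 * pow_pos hn 2)

/-- The limiting number of edges per vertex of the fractal. -/
noncomputable def edgeDensity (n m : ℝ) : ℝ := (m - 1 - n + zeta n m) / (2 * (m - 1))

/-- The limiting growth factor of the number of vertices of the fractal. -/
noncomputable def growthRate (n m : ℝ) : ℝ := (m + n + 1 + zeta n m) / 2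

theorem growthRate_eq (hm : m ≠ 1) : growthRate n m = n + 1 + (m - 1) * edgeDensity n m := by
  have : m - 1 ≠ 0 := sub_ne_zero.2 hm
  rw [growthRate, edgeDensity]
  field_simp
  ring

theorem one_lt_growthRate (hn : 0 < n) (hm : 1 < m) : 1 < growthRate n m := by
  have := lt_zeta hn hm
  rw [growthRate]
  linarith

theorem edgeDensity_fixed (hn : 0 < n) (hm : 1 < m) :
    2 * n + m * edgeDensity n m = (n + 1 + (m - 1) * edgeDensity n m) * edgeDensity n m := by
  have : m - 1 ≠ 0 := (sub_pos.2 hm).ne'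
  rw [edgeDensity]
  field_simp
  linear_combination -zeta_sq hn hm

theorem abs_sub_mul_edgeDensity_lt (hn : 0 < n) (hm : 1 < m) :
    |m - (m - 1) * edgeDensity n m| < n + 1 := by
  have hgrowth := growthRate_eq (n := n) hm.ne'
  have := lt_zeta hn hm
  have := zeta_lt hn hm
  rw [growthRate] at hgrowth
  rw [abs_lt]
  constructor <;> linarith

theorem zeta_sub_alpha₁_mul (hn : 0 < n) (hm : 1 < m) :
    (zeta n m - alpha₁ n m + 1) * (zeta n m + alpha₁ n m - 1) = 8 * (m - 1) * n := by
  rw [alpha₁]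
  linear_combination zeta_sq hn hm

theorem zeta_sub_alpha₂_mul (hn : 0 < n) (hm : 1 < m) :
    (zeta n m - alpha₂ n m + 1) * (zeta n m + alpha₂ n m - 1) = 4 * (m - 1) * n := by
  rw [alpha₂]
  linear_combination zeta_sq hn hm

theorem inv_one_sub_inv_growthRate (hn : 0 < n) (hm : 1 < m) :
    (1 - (growthRate n m)⁻¹)⁻¹ =
      (zeta n m + m + n + 1) * (zeta n m - alpha₂ n m + 1) / (4 * (m - 1) * n) := by
  have hz := lt_zeta hn hm
  have hsub : zeta n m + alpha₂ n m - 1 ≠ 0 := by rw [alpha₂]; linarith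
  have hsub' : zeta n m - alpha₂ n m + 1 ≠ 0 := by rw [alpha₂]; linarith
  have hne : zeta n m + m + n + 1 ≠ 0 := by linarith
  have hone_sub : 1 - (growthRate n m)⁻¹ =
      (zeta n m + alpha₂ n m - 1) / (zeta n m + m + n + 1) := by
    rw [growthRate, alpha₂, inv_div, one_sub_div (by linarith)]
    congr 1 <;> ring
  rw [hone_sub, inv_div, ← zeta_sub_alpha₂_mul hn hm]
  field_simp

theorem coeffA_eq (hn : 0 < n) (hm : 1 < m) :
    coeffA n m = (zeta n m + alpha₁ n m - 1) * (zeta n m - alpha₂ n m + 1) ^ 2 /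
      (32 * (m - 1) ^ 2 * n ^ 3) := by
  have hz := lt_zeta hn hm
  have : 0 < m - 1 := sub_pos.2 hm
  have hsub₁ : zeta n m - alpha₁ n m + 1 ≠ 0 := by rw [alpha₁]; linarith
  have hsub₂ : zeta n m + alpha₂ n m - 1 ≠ 0 := by rw [alpha₂]; linarith
  rw [coeffA, div_eq_div_iff (by positivity) (by positivity)]
  calc 4 * (m - 1) * (32 * (m - 1) ^ 2 * n ^ 3)
      = 8 * (m - 1) * n * (4 * (m - 1) * n) ^ 2 := by ring
    _ = _ := by
      rw [← zeta_sub_alpha₁_mul hn hm, ← zeta_sub_alpha₂_mul hn hm]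
      ring

theorem coeffA_mul_coeffB (hn : 0 < n) (hm : 1 < m) :
    coeffA n m * coeffB n m =
      (edgeDensity n m - 1) * Real.log m * (1 - (growthRate n m)⁻¹)⁻¹ := by
  have hz := lt_zeta hn hm
  have hm' : m - 1 ≠ 0 := (sub_pos.2 hm).ne'
  have hsub : zeta n m - alpha₂ n m + 1 ≠ 0 := by rw [alpha₂]; linarith
  rw [coeffA_eq hn hm, inv_one_sub_inv_growthRate hn hm, coeffB, edgeDensity]
  field_simp
  rw [alpha₁, alpha₂]
  linear_combination 32 * Real.log m * (m + n ^ 2 - 1 - n * zeta n m) * zeta_sq hn hm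

theorem coeffA_mul_coeffC (n : ℕ) (hn : 0 < n) (hm : 1 < m) :
    coeffA n m * coeffC n m =
      Real.log ((1 / 2 * (√5 + 1)) ^ (2 * n) - 2 + coeffD n) * (1 - (growthRate n m)⁻¹)⁻¹ := by
  have hn' : (0 : ℝ) < n := Nat.cast_pos.2 hn
  have hz := lt_zeta hn' hm
  have hm' : m - 1 ≠ 0 := (sub_pos.2 hm).ne'
  have hsub : zeta n m - alpha₂ n m + 1 ≠ 0 := by rw [alpha₂]; linarith
  rw [coeffA_eq hn' hm, inv_one_sub_inv_growthRate hn' hm, coeffC,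
    show -zeta n m + alpha₂ n m - 1 = -(zeta n m - alpha₂ n m + 1) by ring]
  generalize Real.log _ = L
  field_simp
  rw [alpha₁, alpha₂]
  linear_combination 4 * L *
    ((n - 1) * zeta n m + m * n - m + 2 * n + n ^ 2 + 1) * zeta_sq hn' hm

end ClosedForm

/-! ### The fractal -/

section Fractal

open Filter Topology

variable {n m : ℕ} {r : Fin n ⊕ Unit}

instance finite_fractal (n m : ℕ) (r : Fin n ⊕ Unit) (i : ℕ) : Finite (fractal n m r i).1 := by
  induction i with
  | zero => exact inferInstanceAs (Finite (Fin n ⊕ Unit))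
  | succ i ih => exact inferInstanceAs (Finite (SubdivVertex m (fractal n m r i).2 ⊕
      ((fractal n m r i).1 × {u // u ≠ r})))

theorem fractal_connected (hm : m ≠ 0) (i : ℕ) : (fractal n m r i).2.Connected := by
  induction i with
  | zero => exact wheel_connected n
  | succ i ih => exact attach_connected (subdivide_connected hm ih) (wheel_connected n)

/-- The number of edges of the fractal, with the same shift of the index as in `vertexCount`. -/
noncomputable def edgeCount (n m : ℕ) (r : Fin n ⊕ Unit) : ℕ → ℕ
  | 0 => 0
  | i + 1 => Nat.card (fractal n m r i).2.edgeSet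

theorem vertexCount_succ (i : ℕ) : vertexCount n m r (i + 1) =
    (n + 1) * vertexCount n m r i + (m - 1) * edgeCount n m r i := by
  cases i with
  | zero =>
    change Nat.card (Fin n ⊕ Unit) = (n + 1) * 1 + (m - 1) * 0
    simp
  | succ i =>
    change Nat.card (SubdivVertex m (fractal n m r i).2 ⊕
      ((fractal n m r i).1 × {u // u ≠ r})) = (n + 1) * Nat.card (fractal n m r i).1 +
        (m - 1) * Nat.card (fractal n m r i).2.edgeSet
    rw [natCard_attachVertex, natCard_subdivVertex, Nat.card_sum, Nat.card_fin,
      Nat.card_of_subsingleton (), Nat.add_sub_cancel]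
    ring

theorem edgeCount_succ (hn : 3 ≤ n) (hm : 2 ≤ m) (i : ℕ) : edgeCount n m r (i + 1) =
    2 * n * vertexCount n m r i + m * edgeCount n m r i := by
  cases i with
  | zero =>
    change Nat.card (wheel n).edgeSet = 2 * n * 1 + m * 0
    rw [card_edgeSet_wheel hn]
    ring
  | succ i =>
    change Nat.card (attach (subdivide m (fractal n m r i).2) Sum.inl (wheel n) r).edgeSet =
      2 * n * Nat.card (fractal n m r i).1 + m * Nat.card (fractal n m r i).2.edgeSet
    rw [card_edgeSet_attach, card_edgeSet_subdivide hm, card_edgeSet_wheel hn]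
    ring

theorem vertexCount_succ_le (hm : m ≠ 0) (i : ℕ) :
    vertexCount n m r (i + 1) ≤ edgeCount n m r (i + 1) + 1 :=
  (fractal_connected hm i).card_vert_le_card_edgeSet_add_one

theorem vertexCount_pos (i : ℕ) : 0 < vertexCount n m r i := by
  induction i with
  | zero => exact one_pos
  | succ i ih =>
    rw [vertexCount_succ]
    positivity

theorem vertexCount_strictMono (hn : n ≠ 0) : StrictMono (vertexCount n m r) :=
  strictMono_nat_of_lt_succ fun i => by
    have := Nat.mul_pos (Nat.pos_of_ne_zero hn) (vertexCount_pos (m := m) (r := r) i)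
    rw [vertexCount_succ, add_one_mul]
    omega

theorem numSpanningTrees_fractal_succ (hm : 2 ≤ m) (i : ℕ) :
    numSpanningTrees (fractal n m r (i + 1)).2 =
      m ^ (edgeCount n m r (i + 1) + 1 - vertexCount n m r (i + 1)) *
        numSpanningTrees (fractal n m r i).2 *
        numSpanningTrees (wheel n) ^ vertexCount n m r (i + 1) := by
  change numSpanningTrees (attach (subdivide m (fractal n m r i).2) Sum.inl (wheel n) r) = _
  rw [numSpanningTrees_attach, numSpanningTrees_subdivide hm]
  rfl

theorem log_numSpanningTrees_fractal_succ (hm : 2 ≤ m) (i : ℕ) :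
    Real.log (numSpanningTrees (fractal n m r (i + 1)).2) =
      Real.log (numSpanningTrees (fractal n m r i).2) +
      ((edgeCount n m r (i + 1) : ℝ) - vertexCount n m r (i + 1) + 1) * Real.log m +
      vertexCount n m r (i + 1) * Real.log (numSpanningTrees (wheel n)) := by
  have hm0 : m ≠ 0 := by omega
  have hfractal : (numSpanningTrees (fractal n m r i).2 : ℝ) ≠ 0 :=
    Nat.cast_ne_zero.2 (numSpanningTrees_pos (fractal_connected hm0 i)).ne'
  have hwheel : (numSpanningTrees (wheel n) : ℝ) ≠ 0 :=
    Nat.cast_ne_zero.2 (numSpanningTrees_pos (wheel_connected n)).ne'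
  have : (m : ℝ) ≠ 0 := Nat.cast_ne_zero.2 hm0
  rw [numSpanningTrees_fractal_succ hm, Nat.cast_mul, Nat.cast_mul, Nat.cast_pow, Nat.cast_pow,
    Real.log_mul (by positivity) (by positivity), Real.log_mul (by positivity) hfractal,
    Real.log_pow, Real.log_pow, Nat.cast_sub (vertexCount_succ_le hm0 i)]
  push_cast
  ring

theorem cast_vertexCount_succ (hm : m ≠ 0) (i : ℕ) : (vertexCount n m r (i + 1) : ℝ) =
    (n + 1) * vertexCount n m r i + (m - 1) * edgeCount n m r i := by
  rw [vertexCount_succ]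
  push_cast [Nat.cast_sub (Nat.one_le_iff_ne_zero.2 hm)]
  rfl

theorem tendsto_edgeCount_div_vertexCount (hn : 3 ≤ n) (hm : 2 ≤ m) :
    Tendsto (fun i => (edgeCount n m r i : ℝ) / vertexCount n m r i) atTop
      (𝓝 (edgeDensity n m)) := by
  have hn' : (0 : ℝ) < n := Nat.cast_pos.2 (by omega)
  have hm' : (1 : ℝ) < m := Nat.one_lt_cast.2 hm
  exact tendsto_div_of_linear_recurrence (a := n + 1) (b := m - 1) (c := 2 * n) (d := m)
    (by positivity) (sub_pos.2 hm').le (fun i => Nat.cast_pos.2 (vertexCount_pos i))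
    (fun i => Nat.cast_nonneg _) (cast_vertexCount_succ (by omega))
    (fun i => by rw [edgeCount_succ hn hm]; push_cast; rfl)
    (edgeDensity_fixed hn' hm') (abs_sub_mul_edgeDensity_lt hn' hm')

theorem tendsto_vertexCount_div_succ (hn : 3 ≤ n) (hm : 2 ≤ m) :
    Tendsto (fun i => (vertexCount n m r i : ℝ) / vertexCount n m r (i + 1)) atTop
      (𝓝 (growthRate n m)⁻¹) := by
  have hn' : (0 : ℝ) < n := Nat.cast_pos.2 (by omega)
  have hm' : (1 : ℝ) < m := Nat.one_lt_cast.2 hm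
  have hratio := ((tendsto_edgeCount_div_vertexCount (r := r) hn hm).const_mul
    ((m : ℝ) - 1)).const_add ((n : ℝ) + 1)
  rw [← growthRate_eq hm'.ne'] at hratio
  refine (hratio.inv₀ (zero_lt_one.trans (one_lt_growthRate hn' hm')).ne').congr fun i => ?_
  have : (vertexCount n m r i : ℝ) ≠ 0 := Nat.cast_ne_zero.2 (vertexCount_pos i).ne'
  rw [cast_vertexCount_succ (by omega), ← inv_div]
  field_simp

end Fractal

end WheelFractal

theorem mainTheorem4 (n m : ℕ) (hn : 3 ≤ n) (hm : 2 ≤ m) (r : Fin n ⊕ Unit) :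
    Filter.Tendsto
      (fun i : ℕ =>
        Real.log (WheelFractal.numSpanningTrees (WheelFractal.fractal n m r i).2) /
          (WheelFractal.vertexCount n m r i : ℝ))
      Filter.atTop
      (nhds (WheelFractal.coeffA n m *
        (WheelFractal.coeffB n m + WheelFractal.coeffC n m))) := by
  open WheelFractal in
  have hn0 : 0 < n := by omega
  have hn' : (0 : ℝ) < n := Nat.cast_pos.2 hn0
  have hm' : (1 : ℝ) < m := Nat.one_lt_cast.2 hm
  have hmono : StrictMono fun i => (vertexCount n m r i : ℝ) :=
    Nat.strictMono_cast.comp (vertexCount_strictMono hn0.ne')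
  have htop : Filter.Tendsto (fun i => (vertexCount n m r i : ℝ)) Filter.atTop Filter.atTop :=
    tendsto_natCast_atTop_atTop.comp (vertexCount_strictMono hn0.ne').tendsto_atTop
  have hlim := tendsto_div_of_increments
    (ℓ := fun i => Real.log (numSpanningTrees (fractal n m r i).2)) hmono htop
    (fun i => Nat.cast_pos.2 (vertexCount_pos i)) (tendsto_edgeCount_div_vertexCount hn hm)
    (tendsto_vertexCount_div_succ hn hm) (inv_lt_one_of_one_lt₀ (one_lt_growthRate hn' hm')).ne
    (log_numSpanningTrees_fractal_succ hm)
  rwa [numSpanningTrees_wheel hn, div_eq_mul_inv, add_mul, ← coeffA_mul_coeffB hn' hm',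
    ← coeffA_mul_coeffC n hn0 hm', ← mul_add] at hlim
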